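/- Let $S$ be a non-empty set (of any cardinality) and let $G$ be a group acting faithfully on $S$. Let $C=\{0,1\}^{\omega}$ be the Cantor set and let $C^S$ be the space of all functions $S\to C$ with the product topology. Let $\{0,1\}^*$ be the set of finite binary words. For a function $\psi\colon S\to\{0,1\}^*$ such that $\psi(s)$ is the empty word for all but finitely many $s$, the dyadic brick $B(\psi)$ is the set of all $\kappa\in C^S$ such that $\psi(s)$ is a prefix of $\kappa(s)$ for every $s\in S$, and $c_\psi\colon C^S\to B(\psi)$ is the homeomorphism $c_\psi(\kappa)(s)=\psi(s)\cdot\kappa(s)$ (concatenation). For $\gamma\in G$ let $\tau_\gamma\colon C^S\to C^S$ be the homeomorphism $\tau_\gamma(\kappa)(s)=\kappa(\gamma^{-1}s)$. The twisted Brin–Thompson group $SV_G$ is the group of all homeomorphisms $h$ of $C^S$ for which there are two partitions $B(\varphi_1),\dots,B(\varphi_n)$ and $B(\psi_1),\dots,B(\psi_n)$ of $C^S$ into the same finite number of dyadic bricks and elements $\gamma_1,\dots,\gamma_n\in G$ such that $h$ agrees on $B(\varphi_i)$ with $c_{\psi_i}\circ\tau_{\gamma_i}\circ c_{\varphi_i}^{-1}$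 for each $i$. Then $SV_G$ is simple. Moreover, if $SV_G$ is finitely generated, then it is generated by two elements of finite order. -/

import Mathlib

namespace BrinThompson

/-- The Cantor cube `C^S`: all functions from `S` to the Cantor set `C = {0,1}^ω`, with the
product topology (which Lean infers for this function type). -/
abbrev CantorCube (S : Type*) : Type _ := S → ℕ → Bool

/-- A finitely supported function `ψ : S → {0,1}*`. -/
structure Address (S : Type*) where
  word : S → List Bool
  finite_support : {s | word s ≠ []}.Finite

/-- Concatenation of a finite binary word with an infinite one. -/
def prepend (w : List Bool) (x : ℕ → Bool) : ℕ → Bool :=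
  fun n => if h : n < w.length then w[n] else x (n - w.length)

/-- The finite word `w` is a prefix of the infinite word `x`. -/
def IsPrefix (w : List Bool) (x : ℕ → Bool) : Prop :=
  ∀ (n : ℕ) (h : n < w.length), x n = w[n]

section
variable {S : Type*}

/-- The dyadic brick `B(ψ)`: the points `κ` such that `ψ s` is a prefix of `κ s` for all `s`. -/
def brick (ψ : Address S) : Set (CantorCube S) :=
  {κ | ∀ s, IsPrefix (ψ.word s) (κ s)}

/-- The canonical homeomorphism `C^S → B(ψ)`, as a map into `C^S`:
`κ ↦ (s ↦ ψ s · κ s)`. -/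
def canon (ψ : Address S) (κ : CantorCube S) : CantorCube S :=
  fun s => prepend (ψ.word s) (κ s)

/-- The bricks `B(φ i)` form a partition of the Cantor cube: every point lies in exactly one of
them. (Bricks are never empty.) -/
def IsBrickPartition {ι : Type*} (φ : ι → Address S) : Prop :=
  ∀ κ : CantorCube S, ∃! i, κ ∈ brick (φ i)

/-- The twist `τ_γ` of the Cantor cube, `τ_γ κ s = κ (γ⁻¹ s)`. -/
def twist {G : Type*} [Group G] [MulAction G S] (γ : G) (κ : CantorCube S) : CantorCube S :=
  fun s => κ (γ⁻¹ • s)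

/-- `h` maps `B(φ)` to `B(ψ)` via the twist homeomorphism `canon ψ ∘ τ_γ ∘ (canon φ)⁻¹`. -/
def MapsByTwist {G : Type*} [Group G] [MulAction G S]
    (h : CantorCube S → CantorCube S) (φ ψ : Address S) (γ : G) : Prop :=
  ∀ κ, h (canon φ κ) = canon ψ (twist γ κ)

end

/-- `h` is given by two partitions `B(φ 1), …, B(φ n)` and `B(ψ 1), …, B(ψ n)` of the Cantor cube
into the same number of dyadic bricks and by elements `γ 1, …, γ n` of `G`, where each `B(φ i)` is
mapped to `B(ψ i)` via the twist homeomorphism of `γ i`. -/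
def IsTwistedBrinThompson (G S : Type*) [Group G] [MulAction G S]
    (h : CantorCube S ≃ₜ CantorCube S) : Prop :=
  ∃ (n : ℕ) (φ ψ : Fin n → Address S) (γ : Fin n → G),
    IsBrickPartition φ ∧ IsBrickPartition ψ ∧ ∀ i, MapsByTwist h (φ i) (ψ i) (γ i)

/-! Facts needed to see that these homeomorphisms form a group. -/

section
variable {S : Type*}

theorem isPrefix_prepend (w : List Bool) (x : ℕ → Bool) : IsPrefix w (prepend w x) := by
  intro n h
  simp [prepend, h]

theorem prepend_append (u v : List Bool) (x : ℕ → Bool) :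
    prepend (u ++ v) x = prepend u (prepend v x) := by
  funext n
  unfold prepend
  by_cases h1 : n < u.length
  · have h2 : n < (u ++ v).length := by rw [List.length_append]; omega
    rw [dif_pos h2, dif_pos h1, List.getElem_append_left h1]
  · by_cases h2 : n < (u ++ v).length
    · have h3 : n - u.length < v.length := by rw [List.length_append] at h2; omega
      rw [dif_pos h2, dif_neg h1, dif_pos h3, List.getElem_append_right (by omega)]
    · have h3 : ¬ n - u.length < v.length := by rw [List.length_append] at h2; omega
      rw [dif_neg h2, dif_neg h1, dif_neg h3, List.length_append]
      congr 1
      omega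

theorem prepend_drop_of_isPrefix {w : List Bool} {x : ℕ → Bool} (h : IsPrefix w x) :
    prepend w (fun n => x (n + w.length)) = x := by
  funext n
  unfold prepend
  by_cases h1 : n < w.length
  · rw [dif_pos h1, h n h1]
  · rw [dif_neg h1]
    change x (n - w.length + w.length) = x n
    rw [Nat.sub_add_cancel (not_lt.mp h1)]

theorem append_drop_comm {u v : List Bool} {x : ℕ → Bool} (hu : IsPrefix u x)
    (hv : IsPrefix v x) : u ++ v.drop u.length = v ++ u.drop v.length := by
  apply List.ext_getElem
  · simp only [List.length_append, List.length_drop]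
    omega
  · intro n h1 h2
    have key : ∀ {a b : List Bool}, IsPrefix a x → IsPrefix b x →
        ∀ (h : n < (a ++ b.drop a.length).length), (a ++ b.drop a.length)[n] = x n := by
      intro a b ha hb h
      by_cases hn : n < a.length
      · rw [List.getElem_append_left hn, ha n hn]
      · have hb' : n < b.length := by
          simp only [List.length_append, List.length_drop] at h
          omega
        rw [List.getElem_append_right (by omega), List.getElem_drop, hb n hb']
        congr 1
        omega
    rw [key hu hv, key hv hu]

theorem isPrefix_append_drop {u v : List Bool} {x : ℕ → Bool} (hu : IsPrefix u x)
    (hv : IsPrefix v x) : IsPrefix (u ++ v.drop u.length) x := by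
  intro n h
  by_cases hn : n < u.length
  · rw [List.getElem_append_left hn, hu n hn]
  · have hv' : n < v.length := by
      simp only [List.length_append, List.length_drop] at h
      omega
    rw [List.getElem_append_right (by omega), List.getElem_drop, hv n hv']
    congr 1
    omega

theorem canon_mem_brick (ψ : Address S) (κ : CantorCube S) : canon ψ κ ∈ brick ψ :=
  fun s => isPrefix_prepend (ψ.word s) (κ s)

theorem exists_canon_eq {ψ : Address S} {κ : CantorCube S} (h : κ ∈ brick ψ) :
    ∃ κ₀, canon ψ κ₀ = κ :=
  ⟨fun s n => κ s (n + (ψ.word s).length), funext fun s => prepend_drop_of_isPrefix (h s)⟩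

theorem mem_brick_iff {ψ : Address S} {κ : CantorCube S} :
    κ ∈ brick ψ ↔ ∃ κ₀, canon ψ κ₀ = κ :=
  ⟨exists_canon_eq, fun ⟨κ₀, h⟩ => h ▸ canon_mem_brick ψ κ₀⟩

/-- The address with all words empty. -/
def Address.empty : Address S where
  word := fun _ => []
  finite_support := by simp

/-- Coordinatewise concatenation of addresses. -/
def Address.append (φ α : Address S) : Address S where
  word := fun s => φ.word s ++ α.word s
  finite_support := by
    refine (φ.finite_support.union α.finite_support).subset ?_
    intro s hs
    by_contra hcon
    simp only [Set.mem_union, Set.mem_ofPred_eq, not_or, not_not] at hcon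
    exact hs (by rw [hcon.1, hcon.2]; rfl)

/-- What is left of `φ` after removing as many letters as `ψ` has, in every coordinate. -/
def Address.diff (φ ψ : Address S) : Address S where
  word := fun s => (φ.word s).drop (ψ.word s).length
  finite_support := by
    refine φ.finite_support.subset ?_
    intro s hs h
    exact hs (by rw [h]; simp)

/-- The image of an address under the action of a group element. -/
def Address.move {G : Type*} [Group G] [MulAction G S] (γ : G) (α : Address S) : Address S where
  word := fun s => α.word (γ⁻¹ • s)
  finite_support := by
    refine (α.finite_support.image fun s => γ • s).subset ?_
    intro s hs
    exact ⟨γ⁻¹ • s, hs, smul_inv_smul γ s⟩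

theorem canon_empty (κ : CantorCube S) : canon Address.empty κ = κ := by
  funext s n
  simp [canon, Address.empty, prepend]

theorem canon_append (φ α : Address S) (κ : CantorCube S) :
    canon (φ.append α) κ = canon φ (canon α κ) :=
  funext fun s => prepend_append (φ.word s) (α.word s) (κ s)

theorem canon_diff_comm {φ ψ : Address S} {κ : CantorCube S} (hφ : κ ∈ brick φ)
    (hψ : κ ∈ brick ψ) (μ : CantorCube S) :
    canon φ (canon (ψ.diff φ) μ) = canon ψ (canon (φ.diff ψ) μ) := by
  rw [← canon_append, ← canon_append]
  funext s
  change prepend (_ ++ List.drop _ _) _ = prepend (_ ++ List.drop _ _) _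
  rw [append_drop_comm (hφ s) (hψ s)]

theorem exists_canon_diff {φ ψ : Address S} {κ : CantorCube S} (hφ : κ ∈ brick φ)
    (hψ : κ ∈ brick ψ) : ∃ μ, canon φ (canon (ψ.diff φ) μ) = κ := by
  have h : κ ∈ brick (φ.append (ψ.diff φ)) := fun s => isPrefix_append_drop (hφ s) (hψ s)
  obtain ⟨μ, hμ⟩ := exists_canon_eq h
  exact ⟨μ, by rw [← canon_append, hμ]⟩

variable {G : Type*} [Group G] [MulAction G S]

theorem twist_one (κ : CantorCube S) : twist (1 : G) κ = κ := by
  funext s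
  simp [twist]

theorem twist_twist (γ δ : G) (κ : CantorCube S) : twist γ (twist δ κ) = twist (γ * δ) κ := by
  funext s
  simp [twist, mul_smul]

theorem twist_canon (γ : G) (α : Address S) (κ : CantorCube S) :
    twist γ (canon α κ) = canon (α.move γ) (twist γ κ) := rfl

theorem move_move_inv (γ : G) (α : Address S) : (α.move γ⁻¹).move γ = α := by
  cases α
  simp [Address.move]

/-- The image of the brick `B(φ α)` under a map that is a twist on `B(φ)`. -/
theorem image_brick {h : CantorCube S ≃ₜ CantorCube S} {φ ψ : Address S} {γ : G}
    (H : MapsByTwist h φ ψ γ) (κ : CantorCube S) (α : Address S) :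
    h κ ∈ brick (ψ.append (α.move γ)) ↔ κ ∈ brick (φ.append α) := by
  rw [mem_brick_iff, mem_brick_iff]
  constructor
  · rintro ⟨μ, hμ⟩
    refine ⟨twist γ⁻¹ μ, h.injective ?_⟩
    rw [canon_append, H, twist_canon, twist_twist, mul_inv_cancel, twist_one, ← canon_append, hμ]
  · rintro ⟨μ, rfl⟩
    exact ⟨twist γ μ, by rw [canon_append, canon_append, H, twist_canon]⟩

theorem isTwistedBrinThompson_of_finite {ι : Type*} [Finite ι] {h : CantorCube S ≃ₜ CantorCube S}
    (φ ψ : ι → Address S) (γ : ι → G) (hφ : IsBrickPartition φ) (hψ : IsBrickPartition ψ)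
    (H : ∀ i, MapsByTwist h (φ i) (ψ i) (γ i)) : IsTwistedBrinThompson G S h := by
  obtain ⟨n, ⟨e⟩⟩ := Finite.exists_equiv_fin ι
  have key : ∀ φ : ι → Address S, IsBrickPartition φ → IsBrickPartition (φ ∘ e.symm) := by
    intro φ hφ κ
    obtain ⟨i, hi, hu⟩ := hφ κ
    refine ⟨e i, by simpa using hi, fun j hj => ?_⟩
    rw [← hu (e.symm j) hj, Equiv.apply_symm_apply]
  exact ⟨n, φ ∘ e.symm, ψ ∘ e.symm, γ ∘ e.symm, key φ hφ, key ψ hψ, fun i => H (e.symm i)⟩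

theorem isTwistedBrinThompson_one : IsTwistedBrinThompson G S 1 := by
  have hp : IsBrickPartition (fun _ : Fin 1 => (Address.empty : Address S)) := fun κ =>
    ⟨0, mem_brick_iff.2 ⟨κ, canon_empty κ⟩, fun _ _ => Subsingleton.elim _ _⟩
  refine ⟨1, _, _, fun _ => 1, hp, hp, fun _ κ => ?_⟩
  rw [twist_one]
  rfl

theorem IsTwistedBrinThompson.inv {h : CantorCube S ≃ₜ CantorCube S}
    (hh : IsTwistedBrinThompson G S h) : IsTwistedBrinThompson G S h⁻¹ := by
  obtain ⟨n, φ, ψ, γ, hφ, hψ, H⟩ := hh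
  refine ⟨n, ψ, φ, fun i => (γ i)⁻¹, hψ, hφ, fun i κ => ?_⟩
  apply h.injective
  rw [H i, twist_twist, mul_inv_cancel, twist_one]
  exact h.apply_symm_apply _

theorem IsTwistedBrinThompson.mul {g f : CantorCube S ≃ₜ CantorCube S}
    (hg : IsTwistedBrinThompson G S g) (hf : IsTwistedBrinThompson G S f) :
    IsTwistedBrinThompson G S (g * f) := by
  obtain ⟨n, φ, ψ, γ, hφ, hψ, F⟩ := hf
  obtain ⟨m, φ', ψ', γ', hφ', hψ', H⟩ := hg
  let ι := {p : Fin n × Fin m // (brick (ψ p.1) ∩ brick (φ' p.2)).Nonempty}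
  let α : ι → Address S := fun p => (φ' p.1.2).diff (ψ p.1.1)
  let β : ι → Address S := fun p => (ψ p.1.1).diff (φ' p.1.2)
  -- the middle bricks
  have hmid : ∀ (p : ι) (κ : CantorCube S),
      κ ∈ brick ((ψ p.1.1).append (α p)) ↔ κ ∈ brick (ψ p.1.1) ∧ κ ∈ brick (φ' p.1.2) := by
    intro p κ
    obtain ⟨κ₀, h1, h2⟩ := p.2
    constructor
    · intro h
      obtain ⟨μ, rfl⟩ := exists_canon_eq h
      rw [canon_append]
      refine ⟨canon_mem_brick _ _, ?_⟩
      rw [canon_diff_comm h1 h2]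
      exact canon_mem_brick _ _
    · rintro ⟨h3, h4⟩
      obtain ⟨μ, rfl⟩ := exists_canon_diff h3 h4
      rw [← canon_append]
      exact canon_mem_brick _ _
  have hmid' : ∀ (p : ι) (κ : CantorCube S),
      κ ∈ brick ((φ' p.1.2).append (β p)) ↔ κ ∈ brick ((ψ p.1.1).append (α p)) := by
    intro p κ
    obtain ⟨κ₀, h1, h2⟩ := p.2
    rw [mem_brick_iff, mem_brick_iff]
    simp only [canon_append]
    exact exists_congr fun μ => by rw [canon_diff_comm h1 h2]
  have hpart : IsBrickPartition fun p : ι => (ψ p.1.1).append (α p) := by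
    intro κ
    obtain ⟨i, hi, hiu⟩ := hψ κ
    obtain ⟨j, hj, hju⟩ := hφ' κ
    refine ⟨⟨(i, j), κ, hi, hj⟩, (hmid _ _).2 ⟨hi, hj⟩, fun p hp => ?_⟩
    have hp' := (hmid p κ).1 hp
    exact Subtype.ext (Prod.ext (hiu _ hp'.1) (hju _ hp'.2))
  refine isTwistedBrinThompson_of_finite
    (fun p : ι => (φ p.1.1).append ((α p).move (γ p.1.1)⁻¹))
    (fun p : ι => (ψ' p.1.2).append ((β p).move (γ' p.1.2)))
    (fun p : ι => γ' p.1.2 * γ p.1.1) ?_ ?_ ?_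
  · intro κ
    have hiff : ∀ p : ι, κ ∈ brick ((φ p.1.1).append ((α p).move (γ p.1.1)⁻¹)) ↔
        f κ ∈ brick ((ψ p.1.1).append (α p)) := by
      intro p
      rw [← image_brick (F p.1.1), move_move_inv]
    simpa only [hiff] using hpart (f κ)
  · intro κ
    have hiff : ∀ p : ι, κ ∈ brick ((ψ' p.1.2).append ((β p).move (γ' p.1.2))) ↔
        g.symm κ ∈ brick ((ψ p.1.1).append (α p)) := by
      intro p
      rw [← hmid', ← image_brick (H p.1.2), g.apply_symm_apply]
    simpa only [hiff] using hpart (g.symm κ)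
  · intro p κ
    obtain ⟨κ₀, h1, h2⟩ := p.2
    change g (f _) = _
    rw [canon_append, F, twist_canon, move_move_inv, canon_diff_comm h1 h2, H, twist_canon,
      twist_twist, canon_append]

end

/-- The twisted Brin–Thompson group `SV_G`, as a group of homeomorphisms of the Cantor cube. -/
def twistedBrinThompsonGroup (G S : Type*) [Group G] [MulAction G S] :
    Subgroup (CantorCube S ≃ₜ CantorCube S) where
  carrier := {h | IsTwistedBrinThompson G S h}
  mul_mem' := IsTwistedBrinThompson.mul
  one_mem' := isTwistedBrinThompson_one
  inv_mem' := IsTwistedBrinThompson.inv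

end BrinThompson

open Set Filter Topology
open scoped commutatorElement

/-! By compactness, `SV_G` consists of all bijections of the cube that are locally twist
homeomorphisms between bricks (`exists_mem_of_locAt`). Elements can therefore be cut and glued along
clopen sets. In particular, a clopen set with non-empty complement can be moved into any non-empty
clopen set (`exists_rist_mapsTo`), and the group is generated by elements that fix some non-empty
clopen set pointwise (`rist_le`).

Perfectness (`commutator_eq_top`): let `f` be a homomorphism to a commutative group. A transposition
of finite words is a product `y * (k * y * k⁻¹)` with `y` an involution, so `f` kills it, and hence
kills every untwisted map that preserves word lengths. An element `g` is, up to generators,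
conjugate to its copy inside a brick, so performing `g` on both halves of the cube has value `f g *
f g`. Comparing this double with `g` itself gives an element of value `(f g)⁻¹` that is untwisted,
and length-preserving if `g` was untwisted. Two such comparisons give `f g = 1`.

Simplicity: if `g` lies in a normal subgroup and moves a brick off itself, double commutators with
`g` put all commutators of elements supported in that brick into the subgroup. By perfectness it
contains everything supported in the brick, and moving supports around yields the whole group.

Two generators: finitely many commutators of torsion elements `f i` generate the group. Take a
torsion element `σ` permuting cyclically the parts of a clopen partition, two consecutive parts
forming a brick. Let `ζ` be the product of copies of the `f i` on the translates of the brick by `σ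
^ k i`, where the `k i` form a Sidon set. After conjugation by powers of `σ`, the supports of two
distinct translates of `ζ` interact only in the brick, so their commutator is the copy of `⁅f i, f
j⁆`. The subgroup generated by `σ` and `ζ` thus contains everything supported in the brick, and
gluing overlapping translates gives the whole group. -/

namespace BrinThompson

/-! ### Bricks as a clopen basis of the cube -/

section Bricks
variable {S : Type*}

/-- Removal of the prefix `φ`: the inverse of `canon φ` on `brick φ`. -/
def strip (φ : Address S) (κ : CantorCube S) : CantorCube S :=
  fun s n => κ s (n + (φ.word s).length)

theorem canon_strip {φ : Address S} {κ : CantorCube S} (h : κ ∈ brick φ) :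
    canon φ (strip φ κ) = κ :=
  funext fun s => prepend_drop_of_isPrefix (h s)

theorem strip_canon (φ : Address S) (κ : CantorCube S) : strip φ (canon φ κ) = κ := by
  funext s n
  simp [strip, canon, prepend]

theorem canon_injective (φ : Address S) : Function.Injective (canon φ) :=
  Function.LeftInverse.injective (strip_canon φ)

theorem canon_apply_of_lt (φ : Address S) (κ : CantorCube S) {s : S} {n : ℕ}
    (h : n < (φ.word s).length) : canon φ κ s n = (φ.word s)[n] := by
  simp [canon, prepend, h]

theorem canon_apply_of_le (φ : Address S) (κ : CantorCube S) {s : S} {n : ℕ}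
    (h : (φ.word s).length ≤ n) : canon φ κ s n = κ s (n - (φ.word s).length) := by
  simp [canon, prepend, h]

theorem continuous_strip (φ : Address S) : Continuous (strip φ) := by
  unfold strip
  fun_prop

theorem continuous_canon (φ : Address S) : Continuous (canon φ) := by
  refine continuous_pi fun s => continuous_pi fun n => ?_
  by_cases h : n < (φ.word s).length
  · simp only [canon_apply_of_lt _ _ h]
    exact continuous_const
  · simp only [canon_apply_of_le _ _ (not_lt.mp h)]
    fun_prop

theorem continuous_twist {G : Type*} [Group G] [MulAction G S] (γ : G) :
    Continuous (twist γ : CantorCube S → CantorCube S) := by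
  unfold twist
  fun_prop

theorem isClopen_bit (s : S) (n : ℕ) (b : Bool) : IsClopen {κ : CantorCube S | κ s n = b} :=
  (isClopen_discrete ({b} : Set Bool)).preimage
    (f := fun κ : CantorCube S => κ s n) (by fun_prop)

theorem isClopen_brick (φ : Address S) : IsClopen (brick φ) := by
  have : brick φ = ⋂ s ∈ φ.finite_support.toFinset, ⋂ n : Fin (φ.word s).length,
      {κ : CantorCube S | κ s n = (φ.word s)[n]} := by
    ext κ
    simp only [mem_iInter]
    constructor
    · intro h s _ n
      exact h s n n.2
    · intro h s n hn
      refine h s ?_ ⟨n, hn⟩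
      rw [Finite.mem_toFinset]
      intro h0
      rw [h0] at hn
      exact absurd hn (by simp)
  rw [this]
  exact isClopen_biInter_finset fun s _ => isClopen_iInter_of_finite fun n => isClopen_bit _ _ _

theorem brick_nonempty (φ : Address S) : (brick φ).Nonempty :=
  ⟨_, canon_mem_brick φ fun _ _ => false⟩

theorem image_canon_brick (φ α : Address S) : canon φ '' brick α = brick (φ.append α) := by
  ext κ
  rw [mem_brick_iff]
  constructor
  · rintro ⟨μ, hμ, rfl⟩
    obtain ⟨ν, rfl⟩ := exists_canon_eq hμ
    exact ⟨ν, canon_append _ _ _⟩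
  · rintro ⟨ν, rfl⟩
    exact ⟨_, canon_mem_brick α ν, (canon_append _ _ _).symm⟩

theorem brick_append_subset (φ α : Address S) : brick (φ.append α) ⊆ brick φ := by
  rw [← image_canon_brick]
  rintro _ ⟨μ, -, rfl⟩
  exact canon_mem_brick _ _

theorem Address.ext_word {φ ψ : Address S} (h : ∀ s, φ.word s = ψ.word s) : φ = ψ := by
  cases φ
  cases ψ
  congr
  exact funext h

theorem append_diff_of_length_le {φ ψ : Address S} {κ : CantorCube S} (hφ : κ ∈ brick φ)
    (hψ : κ ∈ brick ψ) (h : ∀ s, (φ.word s).length ≤ (ψ.word s).length) :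
    φ.append (ψ.diff φ) = ψ := by
  refine Address.ext_word fun s => ?_
  change φ.word s ++ (ψ.word s).drop _ = _
  rw [append_drop_comm (hφ s) (hψ s), List.drop_eq_nil_of_le (h s), List.append_nil]

/-- The initial `d` letters in the coordinates from `T`. -/
def bits (T : Finset S) (d : ℕ) (κ : CantorCube S) : T → Fin d → Bool := fun s n => κ s n

open Classical in
/-- The address which prescribes the initial `d` letters in the coordinates from `T`. -/
noncomputable def ofBits {T : Finset S} {d : ℕ} (a : T → Fin d → Bool) : Address S where
  word := fun s => if h : s ∈ T then List.ofFn (a ⟨s, h⟩) else []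
  finite_support := T.finite_toSet.subset fun s hs => by
    by_contra h
    exact hs (dif_neg h)

theorem length_ofBits_of_mem {T : Finset S} {d : ℕ} (a : T → Fin d → Bool) {s : S} (h : s ∈ T) :
    ((ofBits a).word s).length = d := by
  simp [ofBits, h]

theorem ofBits_word_of_notMem {T : Finset S} {d : ℕ} (a : T → Fin d → Bool) {s : S} (h : s ∉ T) :
    (ofBits a).word s = [] := by
  simp [ofBits, h]

theorem mem_brick_ofBits {T : Finset S} {d : ℕ} {a : T → Fin d → Bool} {κ : CantorCube S} :
    κ ∈ brick (ofBits a) ↔ bits T d κ = a := by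
  constructor
  · intro h
    funext s n
    have := h s n (by rw [length_ofBits_of_mem a s.2]; exact n.2)
    simpa [ofBits, bits] using this
  · rintro rfl s n hn
    by_cases h : s ∈ T
    · simp [ofBits, h, bits]
    · simp [ofBits, h] at hn

theorem exists_bits_subset {κ : CantorCube S} {U : Set (CantorCube S)} (hU : U ∈ 𝓝 κ) :
    ∃ (T : Finset S) (d : ℕ), ∀ μ, bits T d μ = bits T d κ → μ ∈ U := by
  obtain ⟨V, hVU, hV, hκ⟩ := mem_nhds_iff.1 hU
  obtain ⟨T, u, hu, hTu⟩ := isOpen_pi_iff.1 hV κ hκ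
  have : ∀ s : T, ∃ d : ℕ, ∀ x : ℕ → Bool, (∀ n < d, x n = κ s n) → x ∈ u s := by
    intro s
    obtain ⟨J, v, hv, hJv⟩ := isOpen_pi_iff.1 (hu s s.2).1 (κ s) (hu s s.2).2
    -- Positions start at 0, so the bound must exceed the largest position in `J`.
    refine ⟨J.sup id + 1, fun x hx => hJv fun n hn => ?_⟩
    rw [hx n (Nat.lt_succ_of_le (Finset.le_sup (f := id) hn))]
    exact (hv n hn).2
  choose d hd using this
  refine ⟨T, Finset.univ.sup d, fun μ hμ => hVU (hTu fun s hs => hd ⟨s, hs⟩ _ fun n hn => ?_)⟩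
  have hn' : n < Finset.univ.sup d := lt_of_lt_of_le hn (Finset.le_sup (f := d) (Finset.mem_univ _))
  exact congrFun (congrFun hμ ⟨s, hs⟩) ⟨n, hn'⟩

theorem exists_brick_subset {κ : CantorCube S} {U : Set (CantorCube S)} (hU : U ∈ 𝓝 κ) :
    ∃ φ : Address S, κ ∈ brick φ ∧ brick φ ⊆ U := by
  obtain ⟨T, d, h⟩ := exists_bits_subset hU
  exact ⟨ofBits (bits T d κ), mem_brick_ofBits.2 rfl, fun μ hμ => h μ (mem_brick_ofBits.1 hμ)⟩

theorem exists_append_subset {φ : Address S} {κ : CantorCube S} (hκ : κ ∈ brick φ)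
    {U : Set (CantorCube S)} (hU : U ∈ 𝓝 κ) :
    ∃ α : Address S, κ ∈ brick (φ.append α) ∧ brick (φ.append α) ⊆ U := by
  obtain ⟨κ, rfl⟩ := exists_canon_eq hκ
  obtain ⟨α, h1, h2⟩ := exists_brick_subset ((continuous_canon φ).continuousAt hU)
  refine ⟨α, ?_, ?_⟩
  · rw [← image_canon_brick]
    exact ⟨_, h1, rfl⟩
  · rw [← image_canon_brick]
    rintro _ ⟨μ, hμ, rfl⟩
    exact h2 hμ

end Bricks

/-! ### Local twist homeomorphisms and the local description of the group -/

section Local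
variable {S : Type*} (G : Type*) [Group G] [MulAction G S]

/-- Near `κ`, the map `f` is a twist homeomorphism between two bricks. -/
def LocAt (f : CantorCube S → CantorCube S) (κ : CantorCube S) : Prop :=
  ∃ (φ ψ : Address S) (γ : G), κ ∈ brick φ ∧ MapsByTwist f φ ψ γ

variable {G}

theorem MapsByTwist.append {f : CantorCube S → CantorCube S} {φ ψ : Address S} {γ : G}
    (h : MapsByTwist f φ ψ γ) (α : Address S) :
    MapsByTwist f (φ.append α) (ψ.append (α.move γ)) γ := by
  intro κ
  rw [canon_append, h, twist_canon, canon_append]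

theorem MapsByTwist.apply_eq {f : CantorCube S → CantorCube S} {φ ψ : Address S} {γ : G}
    (h : MapsByTwist f φ ψ γ) {κ : CantorCube S} (hκ : κ ∈ brick φ) :
    f κ = canon ψ (twist γ (strip φ κ)) := by
  rw [← h, canon_strip hκ]

theorem MapsByTwist.apply_mem {f : CantorCube S → CantorCube S} {φ ψ : Address S} {γ : G}
    (h : MapsByTwist f φ ψ γ) {κ : CantorCube S} (hκ : κ ∈ brick φ) : f κ ∈ brick ψ := by
  rw [h.apply_eq hκ]
  exact canon_mem_brick _ _

/-- Composition of two twist homeomorphisms at a common point. -/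
theorem MapsByTwist.comp {f g : CantorCube S → CantorCube S} {φ ψ φ' ψ' : Address S} {γ γ' : G}
    {κ : CantorCube S} (hf : MapsByTwist f φ ψ γ) (hg : MapsByTwist g φ' ψ' γ')
    (hκ : κ ∈ brick φ) (hκ' : f κ ∈ brick φ') :
    κ ∈ brick (φ.append ((φ'.diff ψ).move γ⁻¹)) ∧
      MapsByTwist (fun x => g (f x)) (φ.append ((φ'.diff ψ).move γ⁻¹))
        (ψ'.append ((ψ.diff φ').move γ')) (γ' * γ) := by
  have h1 := hf.apply_mem hκ
  constructor
  · obtain ⟨μ, hμ⟩ := exists_canon_diff h1 hκ'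
    rw [hf.apply_eq hκ] at hμ
    have h2 := canon_injective _ hμ
    rw [← image_canon_brick]
    refine ⟨strip φ κ, ?_, canon_strip hκ⟩
    rw [← twist_one (G := G) (strip φ κ), ← inv_mul_cancel γ, ← twist_twist, ← h2, twist_canon]
    exact canon_mem_brick _ _
  · intro μ
    change g (f _) = _
    rw [canon_append, hf, twist_canon, move_move_inv, canon_diff_comm h1 hκ', hg, twist_canon,
      twist_twist, canon_append]

theorem MapsByTwist.symm {f g : CantorCube S → CantorCube S} {φ ψ : Address S} {γ : G}
    (hf : MapsByTwist f φ ψ γ) (h : ∀ κ ∈ brick φ, g (f κ) = κ) : MapsByTwist g ψ φ γ⁻¹ := by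
  intro κ
  rw [← h _ (canon_mem_brick φ _), hf, twist_twist, mul_inv_cancel, twist_one]

theorem LocAt.comp {f g : CantorCube S → CantorCube S} {κ : CantorCube S}
    (hg : LocAt G g (f κ)) (hf : LocAt G f κ) : LocAt G (fun x => g (f x)) κ := by
  obtain ⟨φ, ψ, γ, hκ, H⟩ := hf
  obtain ⟨φ', ψ', γ', hκ', H'⟩ := hg
  have := H.comp H' hκ hκ'
  exact ⟨_, _, _, this.1, this.2⟩

theorem LocAt.congr {f g : CantorCube S → CantorCube S} {κ : CantorCube S}
    (hf : LocAt G f κ) (h : f =ᶠ[𝓝 κ] g) : LocAt G g κ := by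
  obtain ⟨φ, ψ, γ, hκ, H⟩ := hf
  obtain ⟨α, h1, h2⟩ := exists_append_subset hκ h
  exact ⟨_, _, γ, h1, fun μ => (h2 (canon_mem_brick _ μ)).symm.trans (H.append α μ)⟩

theorem LocAt.congr_on {f g : CantorCube S → CantorCube S} {κ : CantorCube S}
    (hf : LocAt G f κ) {U : Set (CantorCube S)} (hU : IsOpen U) (hκ : κ ∈ U)
    (h : ∀ x ∈ U, g x = f x) : LocAt G g κ :=
  hf.congr (eventually_of_mem (hU.mem_nhds hκ) fun x hx => (h x hx).symm)

theorem LocAt.continuousAt {f : CantorCube S → CantorCube S} {κ : CantorCube S}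
    (hf : LocAt G f κ) : ContinuousAt f κ := by
  obtain ⟨φ, ψ, γ, hκ, H⟩ := hf
  have : Continuous fun x => canon ψ (twist γ (strip φ x)) :=
    (continuous_canon ψ).comp ((continuous_twist γ).comp (continuous_strip φ))
  exact this.continuousAt.congr (eventually_of_mem ((isClopen_brick φ).isOpen.mem_nhds hκ)
    fun x hx => (H.apply_eq hx).symm)

/-- A map undoing `f` near `κ` is local at `f κ`. -/
theorem LocAt.symm {f g : CantorCube S → CantorCube S} {κ : CantorCube S}
    (hf : LocAt G f κ) (h : ∀ᶠ x in 𝓝 κ, g (f x) = x) : LocAt G g (f κ) := by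
  obtain ⟨φ, ψ, γ, hκ, H⟩ := hf
  obtain ⟨α, h1, h2⟩ := exists_append_subset hκ h
  exact ⟨_, _, _, (H.append α).apply_mem h1, (H.append α).symm fun x hx => h2 hx⟩

theorem locAt_id (κ : CantorCube S) : LocAt G (fun x => x) κ :=
  ⟨Address.empty, Address.empty, 1, mem_brick_iff.2 ⟨κ, canon_empty κ⟩,
    fun μ => by rw [twist_one]⟩

theorem locAt_canon (φ : Address S) (κ : CantorCube S) : LocAt G (canon φ) κ :=
  ⟨Address.empty, φ, 1, mem_brick_iff.2 ⟨κ, canon_empty κ⟩,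
    fun μ => by rw [twist_one, canon_empty]⟩

theorem locAt_strip {φ : Address S} {κ : CantorCube S} (h : κ ∈ brick φ) :
    LocAt G (strip φ) κ :=
  ⟨φ, Address.empty, 1, h, fun μ => by rw [twist_one, canon_empty, strip_canon]⟩

theorem locAt_of_mem {g : CantorCube S ≃ₜ CantorCube S} (hg : g ∈ twistedBrinThompsonGroup G S)
    (κ : CantorCube S) : LocAt G g κ := by
  obtain ⟨n, φ, ψ, γ, hφ, -, H⟩ := hg
  obtain ⟨i, hi, -⟩ := hφ κ
  exact ⟨φ i, ψ i, γ i, hi, H i⟩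

/-- A property of addresses that passes to sub-bricks and holds for a cover of the cube holds for
a uniform partition. -/
theorem exists_uniform_of_cover (P : Address S → Prop) (hP : ∀ κ, ∃ φ, P φ ∧ κ ∈ brick φ)
    (happ : ∀ φ α, P φ → P (φ.append α)) (T₀ : Finset S) :
    ∃ (T : Finset S) (d : ℕ), T₀ ⊆ T ∧ ∀ a : T → Fin d → Bool, P (ofBits a) := by
  choose φ hP hφ using hP
  obtain ⟨t, ht⟩ := isCompact_univ.elim_nhds_subcover (fun κ => brick (φ κ))
    fun κ _ => (isClopen_brick _).isOpen.mem_nhds (hφ κ)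
  classical
  -- `T` contains the supports of the finite subcover and the depth bounds its word lengths, so each
  -- uniform brick lies inside every brick of the subcover that it meets.
  let T : Finset S := T₀ ∪ t.biUnion fun κ => (φ κ).finite_support.toFinset
  refine ⟨T, t.sup fun κ => T.sup fun s => ((φ κ).word s).length, Finset.subset_union_left,
    fun a => ?_⟩
  obtain ⟨κ, hκ⟩ := brick_nonempty (ofBits a)
  obtain ⟨μ, hμ, hμκ⟩ := mem_iUnion₂.1 (ht.2 (mem_univ κ))
  have hT : ∀ s ∉ T, (φ μ).word s = [] := by
    intro s hs
    by_contra h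
    exact hs (Finset.mem_union_right _
      (Finset.mem_biUnion.2 ⟨μ, hμ, (Finite.mem_toFinset _).2 h⟩))
  rw [← append_diff_of_length_le hμκ hκ]
  · exact happ _ _ (hP μ)
  · intro s
    by_cases hs : s ∈ T
    · rw [length_ofBits_of_mem _ hs]
      exact (Finset.le_sup (f := fun s => ((φ μ).word s).length) hs).trans
        (Finset.le_sup (f := fun κ => T.sup fun s => ((φ κ).word s).length) hμ)
    · simp [hT s hs]

theorem exists_uniform_of_locAt {f : CantorCube S → CantorCube S} (hf : ∀ κ, LocAt G f κ)
    (T₀ : Finset S) : ∃ (T : Finset S) (d : ℕ), T₀ ⊆ T ∧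
      ∀ a : T → Fin d → Bool, ∃ ψ, ∃ γ : G, MapsByTwist f (ofBits a) ψ γ := by
  refine exists_uniform_of_cover (fun φ => ∃ ψ, ∃ γ : G, MapsByTwist f φ ψ γ) (fun κ => ?_) ?_ T₀
  · obtain ⟨φ, ψ, γ, h1, h2⟩ := hf κ
    exact ⟨φ, ⟨ψ, γ, h2⟩, h1⟩
  · rintro φ α ⟨ψ, γ, h⟩
    exact ⟨_, _, h.append α⟩

/-- A bijection which is locally a twist homeomorphism belongs to the group. -/
theorem exists_mem_of_locAt (f : Equiv.Perm (CantorCube S)) (hf : ∀ κ, LocAt G f κ) :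
    ∃ g ∈ twistedBrinThompsonGroup G S, ∀ κ, g κ = f κ := by
  have hsymm : ∀ κ, LocAt G f.symm κ := fun κ => by
    have := (hf (f.symm κ)).symm (g := f.symm) (Eventually.of_forall fun x => f.symm_apply_apply x)
    rwa [f.apply_symm_apply] at this
  let g : CantorCube S ≃ₜ CantorCube S :=
    ⟨f, continuous_iff_continuousAt.2 fun κ => (hf κ).continuousAt,
      continuous_iff_continuousAt.2 fun κ => (hsymm κ).continuousAt⟩
  refine ⟨g, ?_, fun κ => rfl⟩
  have hg : ∀ κ, LocAt G g κ := hf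
  obtain ⟨T, d, -, key⟩ := exists_uniform_of_locAt hg ∅
  choose ψ γ H using key
  refine isTwistedBrinThompson_of_finite (fun a : T → Fin d → Bool => ofBits a) ψ γ ?_ ?_ H
  · exact fun κ => ⟨bits T d κ, mem_brick_ofBits.2 rfl, fun a ha => (mem_brick_ofBits.1 ha).symm⟩
  · intro κ
    have hiff : ∀ a, κ ∈ brick (ψ a) ↔ g.symm κ ∈ brick (ofBits a) := by
      intro a
      constructor
      · intro h
        obtain ⟨μ, rfl⟩ := exists_canon_eq h
        rw [(H a).symm (g := g.symm) fun x _ => g.symm_apply_apply x]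
        exact canon_mem_brick _ _
      · intro h
        rw [← g.apply_symm_apply κ]
        exact (H a).apply_mem h
    refine ⟨bits T d (g.symm κ), (hiff _).2 (mem_brick_ofBits.2 rfl), fun a ha => ?_⟩
    exact (mem_brick_ofBits.1 ((hiff a).1 ha)).symm

end Local
-- Swaps, supports and moving clopen sets
section
variable {S : Type*}

theorem isClopen_image (g : CantorCube S ≃ₜ CantorCube S) {E : Set (CantorCube S)}
    (hE : IsClopen E) : IsClopen (g '' E) :=
  ⟨g.isClosed_image.2 hE.1, g.isOpen_image.2 hE.2⟩

open Classical in
/-- The address with the word `w` in the coordinate `s` and empty words elsewhere. -/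
noncomputable def Address.single (s : S) (w : List Bool) : Address S where
  word := fun t => if t = s then w else []
  finite_support := (finite_singleton s).subset fun t ht => by
    by_contra h
    exact ht (if_neg h)

theorem single_word_self (s : S) (w : List Bool) : (Address.single s w).word s = w := by
  simp [Address.single]

theorem single_word_of_ne {s t : S} (w : List Bool) (h : t ≠ s) :
    (Address.single s w).word t = [] := by
  simp [Address.single, h]

theorem mem_brick_single {s : S} {w : List Bool} {κ : CantorCube S} :
    κ ∈ brick (Address.single s w) ↔ IsPrefix w (κ s) := by
  constructor
  · intro h
    simpa [single_word_self] using h s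
  · intro h t
    by_cases ht : t = s
    · subst ht
      rwa [single_word_self]
    · rw [single_word_of_ne w ht]
      intro n hn
      exact absurd hn (by simp)

theorem mem_brick_letter {s : S} {b : Bool} {κ : CantorCube S} :
    κ ∈ brick (Address.single s [b]) ↔ κ s 0 = b := by
  rw [mem_brick_single]
  constructor
  · intro h
    simpa using h 0 (by simp)
  · intro h n hn
    have : n = 0 := by simpa using hn
    subst this
    simpa using h

/-- A brick has two disjoint sub-bricks. -/
theorem disjoint_append_letter (φ : Address S) (s : S) :
    Disjoint (brick (φ.append (Address.single s [false])))
      (brick (φ.append (Address.single s [true]))) := by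
  rw [← image_canon_brick, ← image_canon_brick, disjoint_image_iff (canon_injective φ)]
  refine disjoint_left.2 fun κ h1 h2 => ?_
  rw [mem_brick_letter] at h1 h2
  rw [h1] at h2
  exact absurd h2 (by simp)

theorem exists_split [Nonempty S] {W : Set (CantorCube S)} (hW : IsOpen W) (hne : W.Nonempty) :
    ∃ φ ψ : Address S, brick φ ⊆ W ∧ brick ψ ⊆ W ∧ Disjoint (brick φ) (brick ψ) := by
  obtain ⟨κ, hκ⟩ := hne
  obtain ⟨φ, -, h⟩ := exists_brick_subset (hW.mem_nhds hκ)
  exact ⟨_, _, (brick_append_subset _ _).trans h, (brick_append_subset _ _).trans h,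
    disjoint_append_letter φ (Classical.arbitrary S)⟩

variable {G : Type*} [Group G] [MulAction G S]

/-- A local homeomorphism from `E` onto a disjoint `F` gives an involution exchanging them. -/
theorem exists_swap {E F : Set (CantorCube S)} (hE : IsClopen E) (hF : IsClopen F)
    (hEF : Disjoint E F) {f f' : CantorCube S → CantorCube S} (hf : ∀ x ∈ E, LocAt G f x)
    (h1 : ∀ x ∈ E, f x ∈ F) (h2 : ∀ y ∈ F, f' y ∈ E) (h3 : ∀ x ∈ E, f' (f x) = x)
    (h4 : ∀ y ∈ F, f (f' y) = y) :
    ∃ g ∈ twistedBrinThompsonGroup G S, (∀ x ∈ E, g x = f x) ∧ (∀ y ∈ F, g y = f' y) ∧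
      ∀ x, x ∉ E → x ∉ F → g x = x := by
  classical
  have hf' : ∀ y ∈ F, LocAt G f' y := fun y hy => by
    have := (hf _ (h2 y hy)).symm (eventually_of_mem (hE.isOpen.mem_nhds (h2 y hy)) h3)
    rwa [h4 y hy] at this
  let p : CantorCube S → CantorCube S := fun x => if x ∈ E then f x else if x ∈ F then f' x else x
  have pE : ∀ x ∈ E, p x = f x := fun x hx => if_pos hx
  have pF : ∀ x ∈ F, p x = f' x := fun x hx => by
    change ite _ _ _ = _
    rw [if_neg (disjoint_right.1 hEF hx), if_pos hx]
  have pN : ∀ x, x ∉ E → x ∉ F → p x = x := fun x hx hx' => by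
    change ite _ _ _ = _
    rw [if_neg hx, if_neg hx']
  have hp : Function.Involutive p := by
    intro x
    by_cases hx : x ∈ E
    · rw [pE x hx, pF _ (h1 x hx), h3 x hx]
    · by_cases hx' : x ∈ F
      · rw [pF x hx', pE _ (h2 x hx'), h4 x hx']
      · rw [pN x hx hx', pN x hx hx']
  obtain ⟨g, hg, hgp⟩ := exists_mem_of_locAt (G := G) hp.toPerm fun κ => by
    change LocAt G p κ
    by_cases hx : κ ∈ E
    · exact (hf κ hx).congr_on hE.isOpen hx pE
    · by_cases hx' : κ ∈ F
      · exact (hf' κ hx').congr_on hF.isOpen hx' pF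
      · exact (locAt_id κ).congr_on (hE.compl.isOpen.inter hF.compl.isOpen) ⟨hx, hx'⟩
          fun x hx => pN x hx.1 hx.2
  exact ⟨g, hg, fun x hx => (hgp x).trans (pE x hx), fun x hx => (hgp x).trans (pF x hx),
    fun x hx hx' => (hgp x).trans (pN x hx hx')⟩

/-- Used to factor `g`: the swap `s` is trivial away from `E` and its image, while `s * g` is
trivial on `E`. -/
theorem exists_swap_of_mem {g : CantorCube S ≃ₜ CantorCube S}
    (hg : g ∈ twistedBrinThompsonGroup G S) {E : Set (CantorCube S)} (hE : IsClopen E)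
    (h : Disjoint E (g '' E)) :
    ∃ s ∈ twistedBrinThompsonGroup G S, (∀ x ∈ E, s x = g x) ∧ (∀ x ∈ E, s (g x) = x) ∧
      ∀ x, x ∉ E → x ∉ g '' E → s x = x := by
  obtain ⟨s, hs, h1, h2, h3⟩ := exists_swap (G := G) hE (isClopen_image g hE) h (f := g)
    (f' := g.symm) (fun x _ => locAt_of_mem hg x) (fun x hx => mem_image_of_mem g hx)
    (by rintro _ ⟨x, hx, rfl⟩; simpa using hx) (by simp) (by simp)
  refine ⟨s, hs, h1, fun x hx => ?_, h3⟩
  rw [h2 _ (mem_image_of_mem g hx), g.symm_apply_apply]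

/-- Restriction of an element to an invariant clopen set. -/
theorem exists_restrict {g : CantorCube S ≃ₜ CantorCube S}
    (hg : g ∈ twistedBrinThompsonGroup G S) {E : Set (CantorCube S)} (hE : IsClopen E)
    (h : ∀ x, g x ∈ E ↔ x ∈ E) :
    ∃ s ∈ twistedBrinThompsonGroup G S, (∀ x ∈ E, s x = g x) ∧ ∀ x ∉ E, s x = x := by
  classical
  have h' : ∀ x, g.symm x ∈ E ↔ x ∈ E := fun x => by
    rw [← h, g.apply_symm_apply]
  let p : Equiv.Perm (CantorCube S) :=
    { toFun := fun x => if x ∈ E then g x else x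
      invFun := fun x => if x ∈ E then g.symm x else x
      left_inv := fun x => by by_cases hx : x ∈ E <;> simp [hx, h]
      right_inv := fun x => by by_cases hx : x ∈ E <;> simp [hx, h'] }
  have pE : ∀ x ∈ E, p x = g x := fun x hx => if_pos hx
  have pN : ∀ x ∉ E, p x = x := fun x hx => if_neg hx
  obtain ⟨s, hs, hsp⟩ := exists_mem_of_locAt (G := G) p fun κ => by
    by_cases hx : κ ∈ E
    · exact (locAt_of_mem hg κ).congr_on hE.isOpen hx pE
    · exact (locAt_id κ).congr_on hE.compl.isOpen hx pN
  exact ⟨s, hs, fun x hx => (hsp x).trans (pE x hx), fun x hx => (hsp x).trans (pN x hx)⟩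

/-- The elements supported in `A`. -/
def rist (G : Type*) [Group G] [MulAction G S] (A : Set (CantorCube S)) :
    Subgroup (CantorCube S ≃ₜ CantorCube S) where
  carrier := {g | g ∈ twistedBrinThompsonGroup G S ∧ ∀ x ∉ A, g x = x}
  mul_mem' := fun {a b} ha hb => ⟨mul_mem ha.1 hb.1, fun x hx => by
    rw [Homeomorph.mul_apply, hb.2 x hx, ha.2 x hx]⟩
  one_mem' := ⟨one_mem _, fun _ _ => rfl⟩
  inv_mem' := fun {a} ha => ⟨inv_mem ha.1, fun x hx => by
    rw [Homeomorph.inv_apply, Homeomorph.symm_apply_eq, ha.2 x hx]⟩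

theorem mem_rist {A : Set (CantorCube S)} {g : CantorCube S ≃ₜ CantorCube S} :
    g ∈ rist G A ↔ g ∈ twistedBrinThompsonGroup G S ∧ ∀ x ∉ A, g x = x :=
  Iff.rfl

theorem rist_mono {A B : Set (CantorCube S)} (h : A ⊆ B) : rist G A ≤ rist G B :=
  fun _ hg => ⟨hg.1, fun x hx => hg.2 x fun hx' => hx (h hx')⟩

theorem rist_univ : rist G (univ : Set (CantorCube S)) = twistedBrinThompsonGroup G S := by
  ext g
  simp [mem_rist]

theorem apply_mem_of_mem_rist {A : Set (CantorCube S)} {g : CantorCube S ≃ₜ CantorCube S}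
    (hg : g ∈ rist G A) {x : CantorCube S} (hx : x ∈ A) : g x ∈ A := by
  by_contra h
  have := g.injective (hg.2 _ h)
  rw [this] at h
  exact h hx

theorem conj_mem_rist {A B : Set (CantorCube S)} {g h : CantorCube S ≃ₜ CantorCube S}
    (hg : g ∈ twistedBrinThompsonGroup G S) (hh : h ∈ twistedBrinThompsonGroup G S)
    (hA : ∀ x ∉ A, g x = x) (hAB : ∀ x ∈ A, h x ∈ B) : h * g * h⁻¹ ∈ rist G B := by
  refine ⟨mul_mem (mul_mem hh hg) (inv_mem hh), fun y hy => ?_⟩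
  rw [Homeomorph.mul_apply, Homeomorph.mul_apply, Homeomorph.inv_apply]
  rw [hA, h.apply_symm_apply]
  intro hx
  have := hAB _ hx
  rw [h.apply_symm_apply] at this
  exact hy this

/-- Compactness: a piece of `V` inside one small brick can be swapped into a brick of `W'` by a
change of prefix, and two pieces are sent into two disjoint bricks of `W'`. The induction must
therefore allow every target `W'`, while the fixed set `W` keeps all targets disjoint from `V`. -/
theorem exists_compress_subset [Nonempty S] {W : Set (CantorCube S)} (hW : IsClopen W)
    {V : Set (CantorCube S)} (hV : IsClopen V) (hVW : Disjoint V W) {W' : Set (CantorCube S)}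
    (hW' : IsClopen W') (hsub : W' ⊆ W) (hne : W'.Nonempty) :
    ∃ g ∈ rist G (V ∪ W'), ∀ x ∈ V, g x ∈ W' := by
  suffices h : ∃ U, univ ⊆ U ∧ IsClopen U ∧ ∀ V, IsClopen V → V ⊆ U → Disjoint V W →
      ∀ W', IsClopen W' → W' ⊆ W → W'.Nonempty → ∃ g ∈ rist G (V ∪ W'), ∀ x ∈ V, g x ∈ W' by
    obtain ⟨U, hU, -, h⟩ := h
    exact h V hV ((subset_univ V).trans hU) hVW W' hW' hsub hne
  refine isCompact_univ.induction_on (p := fun U' => ∃ U, U' ⊆ U ∧ IsClopen U ∧ ∀ V, IsClopen V →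
    V ⊆ U → Disjoint V W → ∀ W', IsClopen W' → W' ⊆ W → W'.Nonempty →
    ∃ g ∈ rist G (V ∪ W'), ∀ x ∈ V, g x ∈ W') ?_ ?_ ?_ ?_
  · refine ⟨∅, Subset.rfl, isClopen_empty, fun V _ hV _ W' _ _ _ => ⟨1, one_mem _, fun x hx => ?_⟩⟩
    exact absurd (hV hx) (notMem_empty x)
  · rintro s t hst ⟨U, h1, h2⟩
    exact ⟨U, hst.trans h1, h2⟩
  · rintro s t ⟨U₁, hsU, hU₁, H₁⟩ ⟨U₂, htU, hU₂, H₂⟩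
    refine ⟨U₁ ∪ U₂, union_subset_union hsU htU, hU₁.union hU₂, fun V hV hVU hVW W' hW' hsub hne => ?_⟩
    obtain ⟨φ, ψ, hφ, hψ, hφψ⟩ := exists_split hW'.isOpen hne
    obtain ⟨g, hg, hgV⟩ := H₁ (V ∩ U₁) (hV.inter hU₁) inter_subset_right
      (hVW.mono_left inter_subset_left) (brick φ) (isClopen_brick φ) (hφ.trans hsub)
      (brick_nonempty φ)
    obtain ⟨k, hk, hkV⟩ := H₂ (V \ U₁) (hV.diff hU₁)
      (fun x hx => (hVU hx.1).resolve_left hx.2)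
      (hVW.mono_left sdiff_subset) (brick ψ) (isClopen_brick ψ) (hψ.trans hsub)
      (brick_nonempty ψ)
    refine ⟨k * g, mul_mem (rist_mono (union_subset_union sdiff_subset hψ) hk)
      (rist_mono (union_subset_union inter_subset_left hφ) hg), fun x hx => ?_⟩
    rw [Homeomorph.mul_apply]
    by_cases hx1 : x ∈ U₁
    · have h1 := hgV x ⟨hx, hx1⟩
      rw [hk.2]
      · exact hφ h1
      · rintro (h | h)
        · exact disjoint_left.1 hVW h.1 (hsub (hφ h1))
        · exact disjoint_left.1 hφψ h1 h
    · rw [hg.2]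
      · exact hψ (hkV x ⟨hx, hx1⟩)
      · rintro (h | h)
        · exact hx1 h.2
        · exact disjoint_left.1 hVW hx (hsub (hφ h))
  · intro x _
    by_cases hx : x ∈ W
    · refine ⟨W, mem_nhdsWithin_of_mem_nhds (hW.isOpen.mem_nhds hx), W, Subset.rfl, hW, ?_⟩
      intro V hV hVs hVW W' _ _ _
      refine ⟨1, one_mem _, fun y hy => ?_⟩
      exact absurd (hVs hy) (disjoint_left.1 hVW hy)
    · obtain ⟨φ, hφ, hφW⟩ := exists_brick_subset (hW.compl.isOpen.mem_nhds hx)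
      refine ⟨brick φ, mem_nhdsWithin_of_mem_nhds ((isClopen_brick φ).isOpen.mem_nhds hφ), brick φ,
        Subset.rfl, isClopen_brick φ, ?_⟩
      intro V hV hVs hVW W' hW' hsub hne
      obtain ⟨ψ, -, hψ, -, -⟩ := exists_split hW'.isOpen hne
      have hF : IsClopen (brick ψ ∩ (fun y => canon φ (strip ψ y)) ⁻¹' V) :=
        (isClopen_brick ψ).inter (hV.preimage ((continuous_canon φ).comp (continuous_strip ψ)))
      obtain ⟨g, hg, h1, -, h3⟩ := exists_swap (G := G) hV hF
        (hVW.mono_right ((inter_subset_left.trans hψ).trans hsub))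
        (f := fun x => canon ψ (strip φ x)) (f' := fun y => canon φ (strip ψ y))
        (fun x hx => (locAt_canon ψ _).comp (locAt_strip (hVs hx)))
        (fun x hx => ⟨canon_mem_brick _ _, by
          change canon φ (strip ψ (canon ψ (strip φ x))) ∈ V
          rwa [strip_canon, canon_strip (hVs hx)]⟩)
        (fun y hy => hy.2)
        (fun x hx => by rw [strip_canon, canon_strip (hVs hx)])
        (fun y hy => by rw [strip_canon, canon_strip hy.1])
      refine ⟨g, ⟨hg, fun x hx => h3 x (fun h => hx (Or.inl h)) fun h => hx (Or.inr (hψ h.1))⟩,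
        fun x hx => ?_⟩
      rw [h1 x hx]
      exact hψ (canon_mem_brick _ _)

/-- A clopen set can be moved into any non-empty clopen set disjoint from it. -/
theorem exists_compress [Nonempty S] {V W : Set (CantorCube S)} (hV : IsClopen V)
    (hW : IsClopen W) (hVW : Disjoint V W) (hne : W.Nonempty) :
    ∃ g ∈ rist G (V ∪ W), ∀ x ∈ V, g x ∈ W :=
  exists_compress_subset hW hV hVW hW Subset.rfl hne

/-- The group is vigorous. -/
theorem exists_rist_mapsTo [Nonempty S] {A U W : Set (CantorCube S)} (hA : IsClopen A)
    (hU : IsClopen U) (hW : IsClopen W) (hUA : U ⊆ A) (hWA : W ⊆ A) (hne : W.Nonempty)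
    (hne' : (A \ U).Nonempty) : ∃ g ∈ rist G A, ∀ x ∈ U, g x ∈ W := by
  by_cases h : (W \ U).Nonempty
  · obtain ⟨g, hg, hgU⟩ := exists_compress (G := G) hU (hW.diff hU) disjoint_sdiff_right h
    exact ⟨g, rist_mono (union_subset hUA (sdiff_subset.trans hWA)) hg, fun x hx => (hgU x hx).1⟩
  · have hWU : W ⊆ U := sdiff_eq_empty.1 (not_nonempty_iff_eq_empty.1 h)
    -- Here the target lies inside `U`, so `U` is first moved off itself and then back into `W`.
    obtain ⟨g, hg, hgU⟩ := exists_compress (G := G) hU (hA.diff hU) disjoint_sdiff_right hne'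
    have hsub : g '' U ⊆ A \ U := by
      rintro _ ⟨x, hx, rfl⟩
      exact hgU x hx
    obtain ⟨k, hk, hkU⟩ := exists_compress (G := G) (isClopen_image g hU) hW
      (disjoint_left.2 fun x hx hx' => (hsub hx).2 (hWU hx')) hne
    exact ⟨k * g, mul_mem (rist_mono (union_subset (hsub.trans sdiff_subset) hWA) hk)
      (rist_mono (union_subset hUA sdiff_subset) hg), fun x hx => hkU _ (mem_image_of_mem g hx)⟩

/-- A local homeomorphism between clopen sets whose union is proper extends to an element. -/
theorem exists_extend [Nonempty S] {E F : Set (CantorCube S)} (hE : IsClopen E) (hF : IsClopen F)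
    (hEF : (E ∪ F)ᶜ.Nonempty) {f f' : CantorCube S → CantorCube S}
    (hf : ∀ x ∈ E, LocAt G f x) (h1 : ∀ x ∈ E, f x ∈ F) (h2 : ∀ y ∈ F, f' y ∈ E)
    (h3 : ∀ x ∈ E, f' (f x) = x) (h4 : ∀ y ∈ F, f (f' y) = y) :
    ∃ g ∈ twistedBrinThompsonGroup G S, ∀ x ∈ E, g x = f x := by
  -- `E` and `F` may overlap. Moving `E` out of `E ∪ F` first makes a swap with `F` possible.
  obtain ⟨g, hg, hgE⟩ := exists_compress (G := G) hE (hE.union hF).compl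
    (disjoint_left.2 fun x hx hx' => hx' (Or.inl hx)) hEF
  obtain ⟨k, hk, hkE, -, -⟩ := exists_swap (G := G) (isClopen_image g hE) hF
    (disjoint_left.2 fun x hx hx' => by
      obtain ⟨y, hy, rfl⟩ := hx
      exact hgE y hy (Or.inr hx'))
    (f := fun x => f (g.symm x)) (f' := fun y => g (f' y))
    (by
      rintro _ ⟨y, hy, rfl⟩
      refine LocAt.comp ?_ (locAt_of_mem (inv_mem hg.1) (g y))
      rw [g.symm_apply_apply]
      exact hf y hy)
    (by
      rintro _ ⟨y, hy, rfl⟩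
      simpa using h1 y hy)
    (fun y hy => mem_image_of_mem g (h2 y hy))
    (by
      rintro _ ⟨y, hy, rfl⟩
      simpa using h3 y hy)
    (by
      intro y hy
      simpa using h4 y hy)
  refine ⟨k * g, mul_mem hk hg.1, fun x hx => ?_⟩
  rw [Homeomorph.mul_apply, hkE _ (mem_image_of_mem g hx), g.symm_apply_apply]

theorem exists_brick_disjoint_image (g : CantorCube S ≃ₜ CantorCube S) (hg : g ≠ 1) :
    ∃ φ : Address S, Disjoint (brick φ) (g '' brick φ) := by
  obtain ⟨x, hx⟩ : ∃ x, g x ≠ x := by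
    by_contra! h
    exact hg (Homeomorph.ext h)
  obtain ⟨U, V, hU, hV, hxU, hxV, hUV⟩ := t2_separation hx.symm
  obtain ⟨φ, -, hφ⟩ := exists_brick_subset
    ((hU.inter (hV.preimage g.continuous)).mem_nhds ⟨hxU, hxV⟩)
  refine ⟨φ, disjoint_left.2 ?_⟩
  rintro _ h1 ⟨y, hy, rfl⟩
  exact disjoint_left.1 hUV (hφ h1).1 (hφ hy).2

/-- The elements supported in `A` are generated by those fixing a non-empty clopen part of `A`. -/
theorem rist_le [Nonempty S] {A : Set (CantorCube S)}
    {H : Subgroup (CantorCube S ≃ₜ CantorCube S)}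
    (hH : ∀ g ∈ rist G A, ∀ D ⊆ A, IsClopen D → D.Nonempty → (∀ x ∈ D, g x = x) → g ∈ H) :
    rist G A ≤ H := by
  intro g hg
  by_cases h1 : g = 1
  · rw [h1]
    exact one_mem H
  obtain ⟨φ, hφ⟩ := exists_brick_disjoint_image g h1
  have hφA : brick φ ⊆ A := by
    intro x hx
    by_contra h
    exact disjoint_left.1 hφ hx ⟨x, hx, hg.2 x h⟩
  -- Write `g = s⁻¹ * (s * g)`, where `s` swaps `brick η` with its image: `s` fixes `brick θ` and `s
  -- * g` fixes `brick η`.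
  obtain ⟨η, θ, hη, hθ, hηθ⟩ := exists_split (isClopen_brick φ).isOpen (brick_nonempty φ)
  obtain ⟨s, hs, s1, s2, s3⟩ := exists_swap_of_mem hg.1 (isClopen_brick η)
    (hφ.mono hη (image_mono hη))
  have hsA : s ∈ rist G A := by
    refine ⟨hs, fun x hx => s3 x (fun h => hx (hφA (hη h))) ?_⟩
    rintro ⟨y, hy, rfl⟩
    exact hx (apply_mem_of_mem_rist hg (hφA (hη hy)))
  have hsH : s ∈ H := hH s hsA (brick θ) (hθ.trans hφA) (isClopen_brick θ) (brick_nonempty θ)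
    fun x hx => s3 x (disjoint_right.1 hηθ hx) fun h =>
      disjoint_left.1 hφ (hθ hx) (image_mono hη h)
  have hsg : s * g ∈ H := hH (s * g) (mul_mem hsA hg) (brick η) (hη.trans hφA) (isClopen_brick η)
    (brick_nonempty η) fun x hx => s2 x hx
  simpa using mul_mem (inv_mem hsH) hsg

/-- By `rist_le` it suffices to treat `g` fixing a clopen set `D` that meets `A`, say. Push `A \ D`
into `A \ B` by some `v` supported in `A`, then `B \ A` into `A ∩ B` by some `u` supported in `B`.
Since `u` does not touch `A \ B`, conjugation by `u * v` brings `g` into `rist G A`. -/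
theorem rist_union_le [Nonempty S] {A B : Set (CantorCube S)} (hA : IsClopen A)
    (hB : IsClopen B) (hAB : (A ∩ B).Nonempty) {H : Subgroup (CantorCube S ≃ₜ CantorCube S)}
    (hAH : rist G A ≤ H) (hBH : rist G B ≤ H) : rist G (A ∪ B) ≤ H := by
  have key : ∀ {A B : Set (CantorCube S)}, IsClopen A → IsClopen B → (A ∩ B).Nonempty →
      rist G A ≤ H → rist G B ≤ H → ∀ g ∈ rist G (A ∪ B), ∀ D, IsClopen D → (A ∩ D).Nonempty →
      (∀ x ∈ D, g x = x) → g ∈ H := by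
    intro A B hA hB hAB hAH hBH g hg D hD hne hgD
    by_cases hsub : (A \ B).Nonempty
    · obtain ⟨v, hv, hvA⟩ := exists_rist_mapsTo (G := G) hA (hA.diff hD) (hA.diff hB) sdiff_subset
        sdiff_subset hsub (by rwa [sdiff_sdiff_right_self])
      obtain ⟨u, hu, huB⟩ := exists_rist_mapsTo (G := G) hB (hB.diff hA) (hA.inter hB) sdiff_subset
        inter_subset_right hAB (by rwa [sdiff_sdiff_right_self, inter_comm])
      have hmem : u * v * g * (u * v)⁻¹ ∈ rist G A := by
        refine conj_mem_rist (A := (A ∪ B) \ D) hg.1 (mul_mem hu.1 hv.1) ?_ ?_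
        · intro x hx
          by_cases hxD : x ∈ D
          · exact hgD x hxD
          · exact hg.2 x fun h => hx ⟨h, hxD⟩
        · rintro x ⟨hx, hxD⟩
          rw [Homeomorph.mul_apply]
          by_cases hxA : x ∈ A
          · have := hvA x ⟨hxA, hxD⟩
            rw [hu.2 _ this.2]
            exact this.1
          · rw [hv.2 x hxA]
            exact (huB x ⟨hx.resolve_left hxA, hxA⟩).1
      have huv : u * v ∈ H := mul_mem (hBH hu) (hAH hv)
      have := mul_mem (mul_mem (inv_mem huv) (hAH hmem)) huv
      simpa [mul_assoc] using this
    · rw [union_eq_right.2 (sdiff_eq_empty.1 (not_nonempty_iff_eq_empty.1 hsub))] at hg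
      exact hBH hg
  refine rist_le fun g hg D hDsub hD hne hgD => ?_
  obtain ⟨x, hx⟩ := hne
  rcases hDsub hx with h | h
  · exact key hA hB hAB hAH hBH g hg D hD ⟨x, h, hx⟩ hgD
  · rw [union_comm] at hg
    rw [inter_comm] at hAB
    exact key hB hA hAB hBH hAH g hg D hD ⟨x, h, hx⟩ hgD

/-! Copies of the group inside bricks. -/

theorem exists_copy (β : Address S) {g : CantorCube S ≃ₜ CantorCube S}
    (hg : g ∈ twistedBrinThompsonGroup G S) :
    ∃ k ∈ rist G (brick β), ∀ κ, k (canon β κ) = canon β (g κ) := by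
  classical
  let p : Equiv.Perm (CantorCube S) :=
    { toFun := fun x => if x ∈ brick β then canon β (g (strip β x)) else x
      invFun := fun x => if x ∈ brick β then canon β (g.symm (strip β x)) else x
      left_inv := fun x => by
        by_cases hx : x ∈ brick β <;> simp [hx, canon_mem_brick, strip_canon, canon_strip]
      right_inv := fun x => by
        by_cases hx : x ∈ brick β <;> simp [hx, canon_mem_brick, strip_canon, canon_strip] }
  have pE : ∀ x ∈ brick β, p x = canon β (g (strip β x)) := fun x hx => if_pos hx
  have pN : ∀ x ∉ brick β, p x = x := fun x hx => if_neg hx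
  obtain ⟨k, hk, hkp⟩ := exists_mem_of_locAt (G := G) p fun κ => by
    by_cases hx : κ ∈ brick β
    · exact ((locAt_canon β _).comp ((locAt_of_mem hg _).comp (locAt_strip hx))).congr_on
        (isClopen_brick β).isOpen hx pE
    · exact (locAt_id κ).congr_on (isClopen_brick β).compl.isOpen hx pN
  exact ⟨k, ⟨hk, fun x hx => (hkp x).trans (pN x hx)⟩, fun κ => by
    rw [hkp, pE _ (canon_mem_brick β κ), strip_canon]⟩

/-- The copy of `g` acting on `brick β`. -/
noncomputable def copyFun (β : Address S) (g : twistedBrinThompsonGroup G S) :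
    CantorCube S ≃ₜ CantorCube S :=
  (exists_copy β g.2).choose

theorem copyFun_mem (β : Address S) (g : twistedBrinThompsonGroup G S) :
    copyFun β g ∈ rist G (brick β) :=
  (exists_copy β g.2).choose_spec.1

theorem copyFun_canon (β : Address S) (g : twistedBrinThompsonGroup G S) (κ : CantorCube S) :
    copyFun β g (canon β κ) = canon β (g.1 κ) :=
  (exists_copy β g.2).choose_spec.2 κ

theorem eq_of_canon_eq {β : Address S} {g h : CantorCube S ≃ₜ CantorCube S}
    (hg : ∀ x ∉ brick β, g x = x) (hh : ∀ x ∉ brick β, h x = x)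
    (H : ∀ κ, g (canon β κ) = h (canon β κ)) : g = h := by
  refine Homeomorph.ext fun x => ?_
  by_cases hx : x ∈ brick β
  · obtain ⟨κ, rfl⟩ := exists_canon_eq hx
    exact H κ
  · rw [hg x hx, hh x hx]

/-- The embedding of the group into itself given by the action on `brick β`. -/
noncomputable def copy (β : Address S) :
    twistedBrinThompsonGroup G S →* twistedBrinThompsonGroup G S :=
  MonoidHom.mk' (fun g => ⟨copyFun β g, (mem_rist.1 (copyFun_mem β g)).1⟩) fun g h => by
    refine Subtype.ext (eq_of_canon_eq (β := β) (copyFun_mem β _).2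
      (mul_mem (copyFun_mem β g) (copyFun_mem β h)).2 fun κ => ?_)
    change copyFun β (g * h) (canon β κ) = copyFun β g (copyFun β h (canon β κ))
    rw [copyFun_canon, copyFun_canon, copyFun_canon]
    rfl

theorem copy_mem (β : Address S) (g : twistedBrinThompsonGroup G S) :
    (copy β g).1 ∈ rist G (brick β) :=
  copyFun_mem β g

theorem copy_canon (β : Address S) (g : twistedBrinThompsonGroup G S) (κ : CantorCube S) :
    (copy β g).1 (canon β κ) = canon β (g.1 κ) :=
  copyFun_canon β g κ

theorem exists_copy_eq {β : Address S} {g : CantorCube S ≃ₜ CantorCube S}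
    (hg : g ∈ rist G (brick β)) : ∃ u : twistedBrinThompsonGroup G S, (copy β u).1 = g := by
  have hm : ∀ x, g (canon β x) ∈ brick β :=
    fun x => apply_mem_of_mem_rist hg (canon_mem_brick β x)
  have hm' : ∀ x, g.symm (canon β x) ∈ brick β :=
    fun x => apply_mem_of_mem_rist (inv_mem hg) (canon_mem_brick β x)
  let p : Equiv.Perm (CantorCube S) :=
    { toFun := fun x => strip β (g (canon β x))
      invFun := fun x => strip β (g.symm (canon β x))
      left_inv := fun x => by
        change strip β (g.symm (canon β (strip β (g (canon β x))))) = x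
        rw [canon_strip (hm x), g.symm_apply_apply, strip_canon]
      right_inv := fun x => by
        change strip β (g (canon β (strip β (g.symm (canon β x))))) = x
        rw [canon_strip (hm' x), g.apply_symm_apply, strip_canon] }
  obtain ⟨u, hu, hup⟩ := exists_mem_of_locAt (G := G) p fun κ =>
    by
    refine LocAt.comp (g := strip β) (f := fun x => g (canon β x)) (locAt_strip (hm κ)) ?_
    exact (locAt_of_mem hg.1 _).comp (locAt_canon β κ)
  refine ⟨⟨u, hu⟩, eq_of_canon_eq (β := β) (copy_mem β _).2 hg.2 fun κ => ?_⟩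
  rw [copy_canon]
  change canon β (u κ) = _
  rw [hup]
  exact canon_strip (hm κ)

end
-- Triviality of the abelianization
section
variable {S : Type*}

theorem eq_of_length_eq {φ ψ : Address S} {κ : CantorCube S} (hφ : κ ∈ brick φ)
    (hψ : κ ∈ brick ψ) (h : ∀ s, (φ.word s).length = (ψ.word s).length) : φ = ψ := by
  refine Address.ext_word fun s => List.ext_getElem (h s) fun n h1 h2 => ?_
  rw [← hφ s n h1, ← hψ s n h2]

section Perm
variable {T : Finset S} {d : ℕ}

open Classical in
/-- The action of a self-map of the initial segments on the cube. -/
noncomputable def permFun (π : (T → Fin d → Bool) → T → Fin d → Bool) (κ : CantorCube S) :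
    CantorCube S :=
  fun s n => if h : s ∈ T ∧ n < d then π (bits T d κ) ⟨s, h.1⟩ ⟨n, h.2⟩ else κ s n

theorem permFun_of_mem (π : (T → Fin d → Bool) → T → Fin d → Bool) (κ : CantorCube S) {s : S}
    {n : ℕ} (hs : s ∈ T) (hn : n < d) :
    permFun π κ s n = π (bits T d κ) ⟨s, hs⟩ ⟨n, hn⟩ :=
  dif_pos ⟨hs, hn⟩

theorem permFun_of_not (π : (T → Fin d → Bool) → T → Fin d → Bool) (κ : CantorCube S) {s : S}
    {n : ℕ} (h : ¬ (s ∈ T ∧ n < d)) : permFun π κ s n = κ s n :=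
  dif_neg h

theorem bits_permFun (π : (T → Fin d → Bool) → T → Fin d → Bool) (κ : CantorCube S) :
    bits T d (permFun π κ) = π (bits T d κ) := by
  funext s n
  exact permFun_of_mem π κ s.2 n.2

theorem permFun_permFun (π ρ : (T → Fin d → Bool) → T → Fin d → Bool) (κ : CantorCube S) :
    permFun π (permFun ρ κ) = permFun (fun a => π (ρ a)) κ := by
  funext s n
  by_cases h : s ∈ T ∧ n < d
  · rw [permFun_of_mem _ _ h.1 h.2, permFun_of_mem _ _ h.1 h.2, bits_permFun]
  · rw [permFun_of_not _ _ h, permFun_of_not _ _ h, permFun_of_not _ _ h]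

theorem permFun_id (κ : CantorCube S) :
    permFun (fun a : T → Fin d → Bool => a) κ = κ := by
  funext s n
  by_cases h : s ∈ T ∧ n < d
  · rw [permFun_of_mem _ _ h.1 h.2]
    rfl
  · rw [permFun_of_not _ _ h]

theorem permFun_canon_ofBits (π : (T → Fin d → Bool) → T → Fin d → Bool) (a : T → Fin d → Bool)
    (κ : CantorCube S) : permFun π (canon (ofBits a) κ) = canon (ofBits (π a)) κ := by
  have ha : bits T d (canon (ofBits a) κ) = a := mem_brick_ofBits.1 (canon_mem_brick _ _)
  have hb : bits T d (canon (ofBits (π a)) κ) = π a := mem_brick_ofBits.1 (canon_mem_brick _ _)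
  funext s n
  by_cases h : s ∈ T ∧ n < d
  · rw [permFun_of_mem _ _ h.1 h.2, ha]
    exact (congrFun (congrFun hb ⟨s, h.1⟩) ⟨n, h.2⟩).symm
  · rw [permFun_of_not _ _ h]
    by_cases hs : s ∈ T
    · have hn : d ≤ n := not_lt.1 fun hn => h ⟨hs, hn⟩
      have h1 := length_ofBits_of_mem a hs
      have h2 := length_ofBits_of_mem (π a) hs
      rw [canon_apply_of_le _ _ (by omega), canon_apply_of_le _ _ (by omega), h1, h2]
    · simp [canon, ofBits_word_of_notMem _ hs]

variable (G : Type*) [Group G] [MulAction G S]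

theorem exists_perm (π : Equiv.Perm (T → Fin d → Bool)) :
    ∃ g ∈ twistedBrinThompsonGroup G S, ∀ κ, g κ = permFun π κ := by
  let p : Equiv.Perm (CantorCube S) :=
    { toFun := permFun π
      invFun := permFun π.symm
      left_inv := fun κ => by simp [permFun_permFun, permFun_id]
      right_inv := fun κ => by simp [permFun_permFun, permFun_id] }
  refine exists_mem_of_locAt (G := G) p fun κ => ?_
  exact ⟨ofBits (bits T d κ), _, 1, mem_brick_ofBits.2 rfl, fun μ => by
    rw [twist_one]
    exact permFun_canon_ofBits _ _ _⟩

/-- The permutations of the initial segments, as elements of the group. -/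
noncomputable def permHom :
    Equiv.Perm (T → Fin d → Bool) →* twistedBrinThompsonGroup G S :=
  MonoidHom.mk' (fun π => ⟨(exists_perm G π).choose, (exists_perm G π).choose_spec.1⟩)
    fun π ρ => Subtype.ext <| Homeomorph.ext fun κ => by
      change (exists_perm G (π * ρ)).choose κ =
        (exists_perm G π).choose ((exists_perm G ρ).choose κ)
      rw [(exists_perm G (π * ρ)).choose_spec.2, (exists_perm G π).choose_spec.2,
        (exists_perm G ρ).choose_spec.2, permFun_permFun]
      rfl

theorem permHom_apply (π : Equiv.Perm (T → Fin d → Bool)) (κ : CantorCube S) :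
    (permHom G π).1 κ = permFun π κ :=
  (exists_perm G π).choose_spec.2 κ

open Classical in
/-- Flipping the letter `n` in the coordinate `s`. -/
theorem exists_flip (s : S) (n : ℕ) : ∃ k : twistedBrinThompsonGroup G S, ∀ κ t m,
    (k.1 κ) t m = if t = s ∧ m = n then !κ t m else κ t m := by
  let f : (({s} : Finset S) → Fin (n + 1) → Bool) → ({s} : Finset S) → Fin (n + 1) → Bool :=
    fun a t m => if m.1 = n then !a t m else a t m
  have hf : Function.Involutive f := by
    intro a
    funext t m
    by_cases h : m.1 = n <;> simp [f, h]
  refine ⟨permHom G hf.toPerm, fun κ t m => ?_⟩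
  rw [permHom_apply]
  by_cases h : t ∈ ({s} : Finset S) ∧ m < n + 1
  · rw [permFun_of_mem _ _ h.1 h.2]
    have := Finset.mem_singleton.1 h.1
    change (if m = n then !κ t m else κ t m) = _
    simp [this]
  · rw [permFun_of_not _ _ h, if_neg]
    rintro ⟨rfl, rfl⟩
    simp at h

instance nontrivial_group [Nonempty S] : Nontrivial (twistedBrinThompsonGroup G S) := by
  obtain ⟨k, hk⟩ := exists_flip G (Classical.arbitrary S) 0
  refine ⟨k, 1, fun h => ?_⟩
  have := hk (fun _ _ => false) (Classical.arbitrary S) 0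
  rw [h] at this
  simp at this

end Perm

variable {G : Type*} [Group G] [MulAction G S]
variable {A : Type*} [CommGroup A] (f : twistedBrinThompsonGroup G S →* A)

/-- An involution that splits into two conjugate parts is trivial in the abelianization. -/
theorem map_eq_one_of_involution {x k : twistedBrinThompsonGroup G S} (hx : x * x = 1)
    (hxk : k * x = x * k) {E : Set (CantorCube S)} (hE : IsClopen E)
    (hxE : ∀ κ, x.1 κ ∈ E ↔ κ ∈ E) (hkE : ∀ κ, k.1 κ ∈ E ↔ κ ∉ E) : f x = 1 := by
  obtain ⟨y, hy, hyE, hyN⟩ := exists_restrict x.2 hE hxE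
  have hx' : ∀ κ, x.1 (x.1 κ) = κ := fun κ => congrArg (fun g => g.1 κ) hx
  have hxk' : ∀ κ, k.1 (x.1 κ) = x.1 (k.1 κ) := fun κ => congrArg (fun g => g.1 κ) hxk
  have hyy : (⟨y, hy⟩ : twistedBrinThompsonGroup G S) * ⟨y, hy⟩ = 1 := by
    refine Subtype.ext (Homeomorph.ext fun κ => ?_)
    change y (y κ) = κ
    by_cases h : κ ∈ E
    · rw [hyE _ h, hyE _ ((hxE κ).2 h), hx']
    · rw [hyN _ h, hyN _ h]
  -- With `y` the restriction of `x` to `E`, this says that `x` is `y` times its conjugate by `k`.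
  -- Hence `f x = f y * f y = f (y * y) = 1`.
  have hxy : x * k = ⟨y, hy⟩ * (k * ⟨y, hy⟩) := by
    refine Subtype.ext (Homeomorph.ext fun κ => ?_)
    change x.1 (k.1 κ) = y (k.1 (y κ))
    by_cases h : κ ∈ E
    · rw [hyE _ h, hyN, hxk']
      rw [hkE, hxE, not_not]
      exact h
    · rw [hyN _ h, hyE _ ((hkE κ).2 h)]
  have h1 := congrArg f hxy
  have h2 := congrArg f hyy
  simp only [map_mul, map_one] at h1 h2
  rw [mul_left_comm, h2, mul_one, mul_comm] at h1
  exact mul_eq_left.1 h1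

theorem map_permHom [Nonempty S] {T : Finset S} {d : ℕ} (π : Equiv.Perm (T → Fin d → Bool)) :
    f (permHom G π) = 1 := by
  classical
  induction π using Equiv.Perm.swap_induction_on with
  | one => rw [map_one, map_one]
  | swap_mul π a b _ ih =>
    rw [map_mul, map_mul, ih, mul_one]
    let s : S := Classical.arbitrary S
    -- Letter `d` is the first one untouched by the permutation. Its value splits a transposition
    -- into two halves, exchanged by the flip `k`, which commutes with it.
    obtain ⟨k, hk⟩ := exists_flip G s d
    have hnot : ∀ {t : S} {m : ℕ}, t = s ∧ m = d → ¬ (t ∈ T ∧ m < d) := by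
      rintro t m ⟨-, rfl⟩ ⟨-, h⟩
      exact lt_irrefl _ h
    have hbits : ∀ κ, bits T d (k.1 κ) = bits T d κ := by
      intro κ
      funext t m
      change k.1 κ t m = κ t m
      rw [hk, if_neg fun h => hnot h ⟨t.2, m.2⟩]
    refine map_eq_one_of_involution f (k := k) ?_ ?_ (isClopen_bit s d false) ?_ ?_
    · rw [← map_mul, Equiv.swap_mul_self, map_one]
    · refine Subtype.ext (Homeomorph.ext fun κ => ?_)
      change k.1 ((permHom G _).1 κ) = (permHom G _).1 (k.1 κ)
      rw [permHom_apply, permHom_apply]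
      funext t m
      by_cases h : t ∈ T ∧ m < d
      · rw [hk, if_neg fun h' => hnot h' h, permFun_of_mem _ _ h.1 h.2,
          permFun_of_mem _ _ h.1 h.2, hbits]
      · rw [hk, permFun_of_not _ _ h, permFun_of_not _ _ h, hk]
    · intro κ
      simp only [mem_ofPred_eq]
      rw [permHom_apply, permFun_of_not _ _ (hnot ⟨rfl, rfl⟩)]
    · intro κ
      simp [hk]

/-- Untwisted maps preserving the lengths of all words are trivial in the abelianization. -/
theorem map_eq_one_of_level [Nonempty S] (g : twistedBrinThompsonGroup G S)
    (hg : ∀ κ, ∃ φ ψ : Address S, κ ∈ brick φ ∧ (∀ s, (φ.word s).length = (ψ.word s).length) ∧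
      MapsByTwist g.1 φ ψ (1 : G)) : f g = 1 := by
  obtain ⟨T, d, -, h⟩ := exists_uniform_of_cover
    (fun φ => ∃ ψ : Address S, (∀ s, (φ.word s).length = (ψ.word s).length) ∧
      MapsByTwist g.1 φ ψ (1 : G))
    (fun κ => by
      obtain ⟨φ, ψ, h1, h2⟩ := hg κ
      exact ⟨φ, ⟨ψ, h2⟩, h1⟩)
    (by
      rintro φ α ⟨ψ, h1, h2⟩
      refine ⟨_, fun s => ?_, h2.append α⟩
      change (_ ++ _ : List Bool).length = (_ ++ α.word ((1 : G)⁻¹ • s)).length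
      rw [inv_one, one_smul, List.length_append, List.length_append, h1]) ∅
  choose ψ hlen H using h
  -- Equal lengths force the image bricks to belong to the same uniform partition, so `g` just
  -- permutes words.
  have key : ∀ a, ∃ b : T → Fin d → Bool, ψ a = ofBits b := by
    intro a
    obtain ⟨κ, hκ⟩ := brick_nonempty (ψ a)
    refine ⟨bits T d κ, eq_of_length_eq hκ (mem_brick_ofBits.2 rfl) fun s => ?_⟩
    rw [← hlen]
    by_cases hs : s ∈ T
    · rw [length_ofBits_of_mem _ hs, length_ofBits_of_mem _ hs]
    · rw [ofBits_word_of_notMem _ hs, ofBits_word_of_notMem _ hs]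
  choose π hπ using key
  have hgπ : ∀ a μ, g.1 (canon (ofBits a) μ) = canon (ofBits (π a)) μ := by
    intro a μ
    rw [H a μ, twist_one, hπ]
  have hinj : Function.Injective π := by
    intro a b hab
    have h1 := (hgπ a fun _ _ => false).trans ((hab ▸ hgπ b fun _ _ => false : _).symm)
    have h2 := g.1.injective h1
    rw [← (mem_brick_ofBits (a := a)).1 (canon_mem_brick _ fun _ _ => false), h2]
    exact mem_brick_ofBits.1 (canon_mem_brick _ _)
  have : g = permHom G (Equiv.ofBijective π (Finite.injective_iff_bijective.1 hinj)) := by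
    refine Subtype.ext (Homeomorph.ext fun κ => ?_)
    obtain ⟨μ, hμ⟩ := exists_canon_eq
      ((mem_brick_ofBits (a := bits T d κ)).2 rfl)
    rw [← hμ, hgπ, permHom_apply, permFun_canon_ofBits]
    rfl
  rw [this, map_permHom]

/-- The map `canon β` is not surjective, but its restriction to `Dᶜ` extends to an element `k`,
since `D` leaves room outside both domain and image. As `g` lives on `Dᶜ`, conjugation by `k` turns
`g` into its copy. -/
theorem map_copy_of_fixed [Nonempty S] {β : Address S} (g : twistedBrinThompsonGroup G S)
    {D : Set (CantorCube S)} (hD : IsClopen D) (hne : D.Nonempty) (hDβ : Disjoint D (brick β))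
    (hgD : ∀ x ∈ D, g.1 x = x) : f (copy β g) = f g := by
  have hF : IsClopen (brick β ∩ strip β ⁻¹' Dᶜ) :=
    (isClopen_brick β).inter (hD.compl.preimage (continuous_strip β))
  obtain ⟨k, hk, hkE⟩ := exists_extend (G := G) hD.compl hF
    (by
      obtain ⟨x, hx⟩ := hne
      refine ⟨x, ?_⟩
      rintro (h | h)
      · exact h hx
      · exact disjoint_left.1 hDβ hx h.1)
    (f := canon β) (f' := strip β) (fun x _ => locAt_canon β x)
    (fun x hx => ⟨canon_mem_brick β x, by
      change strip β (canon β x) ∈ Dᶜ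
      rwa [strip_canon]⟩)
    (fun y hy => hy.2) (fun x _ => strip_canon β x) (fun y hy => canon_strip hy.1)
  have hgr : g.1 ∈ rist G Dᶜ := ⟨g.2, fun x hx => hgD x (not_not.1 hx)⟩
  have : copy β g * ⟨k, hk⟩ = ⟨k, hk⟩ * g := by
    refine Subtype.ext (Homeomorph.ext fun x => ?_)
    change (copy β g).1 (k x) = k (g.1 x)
    by_cases hx : x ∈ D
    · rw [hgD x hx]
      by_cases hkx : k x ∈ brick β
      · obtain ⟨z, hz⟩ := exists_canon_eq hkx
        rw [← hz, copy_canon]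
        by_cases hzD : z ∈ D
        · rw [hgD z hzD]
        · rw [← hkE z hzD] at hz
          rw [k.injective hz] at hzD
          exact absurd hx hzD
      · exact (copy_mem β g).2 _ hkx
    · rw [hkE x hx, copy_canon, hkE _ (apply_mem_of_mem_rist hgr hx)]
  have h := congrArg f this
  rw [map_mul, map_mul, mul_comm] at h
  exact mul_left_cancel h

theorem map_copy [Nonempty S] {β : Address S} (hβ : (brick β)ᶜ.Nonempty)
    (g : twistedBrinThompsonGroup G S) : f (copy β g) = f g := by
  -- The elements on which `f ∘ copy β` and `f` agree form a subgroup, so by `rist_le` one may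
  -- assume that `g` fixes a clopen set `D`. If `D` lies inside the brick, conjugate `g` to move `D`
  -- outside; neither homomorphism notices.
  suffices h : rist G univ ≤
      ((f.comp (copy β)).eqLocus f).map (twistedBrinThompsonGroup G S).subtype by
    rw [rist_univ] at h
    obtain ⟨g', hg', hgg'⟩ := h g.2
    rw [Subtype.ext hgg'] at hg'
    exact hg'
  refine rist_le fun g hg D _ hD hne hgD => ⟨⟨g, hg.1⟩, ?_, rfl⟩
  change f (copy β _) = f _
  by_cases h : (D \ brick β).Nonempty
  · exact map_copy_of_fixed f _ (hD.diff (isClopen_brick β)) h disjoint_sdiff_left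
      fun x hx => hgD x hx.1
  · have hDβ : D ⊆ brick β := sdiff_eq_empty.1 (not_nonempty_iff_eq_empty.1 h)
    obtain ⟨k, hk, hkD⟩ := exists_compress (G := G) hD (isClopen_brick β).compl
      (disjoint_left.2 fun x hx hx' => hx' (hDβ hx)) hβ
    have := map_copy_of_fixed f (β := β)
      (⟨k, hk.1⟩ * ⟨g, hg.1⟩ * ⟨k, hk.1⟩⁻¹ : twistedBrinThompsonGroup G S)
      (isClopen_image k hD) (hne.image k)
      (disjoint_left.2 (by
        rintro _ ⟨x, hx, rfl⟩
        exact hkD x hx))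
      (by
        rintro _ ⟨x, hx, rfl⟩
        change k (g (k.symm (k x))) = k x
        rw [k.symm_apply_apply, hgD x hx])
    simpa only [map_mul, map_inv, mul_inv_cancel_comm] using this

theorem compl_brick_letter_nonempty (s : S) (b : Bool) :
    (brick (Address.single s [b]))ᶜ.Nonempty := by
  refine ⟨fun _ _ => !b, ?_⟩
  rw [mem_compl_iff, mem_brick_letter]
  simp

/-- The action of `g` on both halves of the cube. -/
noncomputable def double (s : S) (g : twistedBrinThompsonGroup G S) :
    twistedBrinThompsonGroup G S :=
  copy (Address.single s [false]) g * copy (Address.single s [true]) g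

theorem map_double [Nonempty S] (s : S) (g : twistedBrinThompsonGroup G S) :
    f (double s g) = f g * f g := by
  rw [double, map_mul, map_copy f (compl_brick_letter_nonempty s _),
    map_copy f (compl_brick_letter_nonempty s _)]

theorem canon_letter_notMem (s : S) {b c : Bool} (h : b ≠ c) (κ : CantorCube S) :
    canon (Address.single s [b]) κ ∉ brick (Address.single s [c]) := by
  have := mem_brick_letter.1 (canon_mem_brick (Address.single s [b]) κ)
  rw [mem_brick_letter, this]
  exact h

theorem double_canon (s : S) (b : Bool) (g : twistedBrinThompsonGroup G S) (κ : CantorCube S) :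
    (double s g).1 (canon (Address.single s [b]) κ) = canon (Address.single s [b]) (g.1 κ) := by
  change (copy _ g).1 ((copy _ g).1 _) = _
  cases b
  · rw [(copy_mem (Address.single s [true]) g).2 _ (canon_letter_notMem s (by simp) κ), copy_canon]
  · rw [copy_canon, (copy_mem (Address.single s [false]) g).2 _ (canon_letter_notMem s (by simp) _)]

open Classical in
/-- Cyclic rotation of the first `d + 1` letters in the coordinate `s`. -/
noncomputable def rot (s : S) (d : ℕ) : Equiv.Perm (CantorCube S) where
  toFun κ := fun t n =>
    if t = s then κ t (if n < d then n + 1 else if n = d then 0 else n) else κ t n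
  invFun κ := fun t n => if t = s then κ t (if n = 0 then d else if n ≤ d then n - 1 else n)
    else κ t n
  left_inv κ := by
    funext t n
    by_cases ht : t = s
    · simp only [if_pos ht]
      congr 1
      grind
    · simp only [if_neg ht]
  right_inv κ := by
    funext t n
    by_cases ht : t = s
    · simp only [if_pos ht]
      congr 1
      grind
    · simp only [if_neg ht]

/-- The rotation carries the leading letter `b` past the word of `φ` in coordinate `s`. -/
theorem rot_canon (s : S) (b : Bool) (φ : Address S) (κ : CantorCube S) :
    rot s (φ.word s).length (canon (Address.single s [b]) (canon φ κ)) =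
      canon φ (canon (Address.single s [b]) κ) := by
  funext t n
  by_cases ht : t = s
  · subst ht
    have h1 : ((Address.single t [b]).word t) = [b] := single_word_self _ _
    simp only [rot, Equiv.coe_fn_mk, if_true, canon, h1]
    rcases lt_trichotomy n (φ.word t).length with h | h | h
    · simp [prepend, h]
    · simp [prepend, h]
    · have h2 : ¬ n < (φ.word t).length := by omega
      have h3 : n ≠ (φ.word t).length := by omega
      have h4 : n ≠ 0 := by omega
      have h5 : ¬ n - 1 < (φ.word t).length := by omega
      have h6 : n - (φ.word t).length ≠ 0 := by omega
      simp [prepend, h2, h3, h4, h5, h6]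
      congr 1
      omega
  · have h1 : ((Address.single s [b]).word t) = [] := single_word_of_ne _ ht
    simp [rot, canon, h1, ht, prepend]

theorem exists_word_length (s : S) (d : ℕ) (κ : CantorCube S) :
    ∃ φ : Address S, κ ∈ brick φ ∧ (φ.word s).length = d :=
  ⟨ofBits (bits {s} d κ), mem_brick_ofBits.2 rfl,
    length_ofBits_of_mem _ (Finset.mem_singleton_self s)⟩

theorem mem_brick_letter_self (s : S) (κ : CantorCube S) :
    κ ∈ brick (Address.single s [κ s 0]) :=
  mem_brick_letter.2 rfl

theorem rot_spec (s : S) (d : ℕ) (κ : CantorCube S) : ∃ φ ψ : Address S, κ ∈ brick φ ∧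
    (∀ s, (φ.word s).length = (ψ.word s).length) ∧ MapsByTwist (rot s d) φ ψ (1 : G) := by
  obtain ⟨μ, hμ⟩ := exists_canon_eq (mem_brick_letter_self s κ)
  obtain ⟨φ, hφ, rfl⟩ := exists_word_length s d μ
  refine ⟨(Address.single s [κ s 0]).append φ, φ.append (Address.single s [κ s 0]), ?_,
    fun t => ?_, fun ν => ?_⟩
  · have := mem_image_of_mem (canon (Address.single s [κ s 0])) hφ
    rwa [hμ, image_canon_brick] at this
  · change (_ ++ _ : List Bool).length = (_ ++ _ : List Bool).length
    rw [List.length_append, List.length_append, add_comm]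
  · rw [twist_one, canon_append, canon_append, rot_canon]

theorem exists_rot (s : S) (d : ℕ) : ∃ r : twistedBrinThompsonGroup G S, ∀ κ, r.1 κ = rot s d κ := by
  obtain ⟨r, hr, h⟩ := exists_mem_of_locAt (G := G) (rot s d) fun κ => by
    obtain ⟨φ, ψ, h1, -, h2⟩ := rot_spec (G := G) s d κ
    exact ⟨φ, ψ, 1, h1, h2⟩
  exact ⟨⟨r, hr⟩, h⟩

theorem map_rot [Nonempty S] {s : S} {d : ℕ} {r : twistedBrinThompsonGroup G S}
    (hr : ∀ κ, r.1 κ = rot s d κ) : f r = 1 := by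
  refine map_eq_one_of_level f r fun κ => ?_
  have : ⇑r.1 = rot s d := funext hr
  rw [this]
  exact rot_spec s d κ

/-- The comparison of `g` with its double. -/
theorem exists_compare [Nonempty S] (s : S) (g : twistedBrinThompsonGroup G S) {d : ℕ}
    {P : G → Prop}
    (hg : ∀ κ, ∃ (φ ψ : Address S) (γ : G), κ ∈ brick φ ∧ (φ.word s).length = d ∧ P γ ∧
      MapsByTwist g.1 φ ψ γ) :
    ∃ w : twistedBrinThompsonGroup G S, f w = (f g)⁻¹ ∧ ∀ κ, ∃ (ψ α : Address S) (γ : G), P γ ∧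
      κ ∈ brick (α.append ψ) ∧ MapsByTwist w.1 (α.append ψ) (ψ.append (α.move γ)) (1 : G) := by
  obtain ⟨r, hr⟩ := exists_rot (G := G) s d
  -- On the brick of `b` followed by `φ`, the double puts `b` before `ψ`, while `g * r` puts the
  -- moved `b` after `ψ`. Both twist by the same `γ`, which therefore cancels. A single rotation
  -- serves all bricks because their words in coordinate `s` have the common length `d`.
  refine ⟨g * r * (double s g)⁻¹, ?_, fun κ => ?_⟩
  · rw [map_mul, map_mul, map_inv, map_double, map_rot f hr, mul_one, mul_inv,
      mul_inv_cancel_left]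
  · obtain ⟨x, rfl⟩ := (double s g).1.surjective κ
    obtain ⟨y, hy⟩ := exists_canon_eq (mem_brick_letter_self s x)
    obtain ⟨φ, ψ, γ, hφ, hd, hγ, H⟩ := hg y
    refine ⟨ψ, Address.single s [x s 0], γ, hγ, ?_, fun μ => ?_⟩
    · generalize x s 0 = b at hy
      rw [← hy, double_canon, ← image_canon_brick]
      exact mem_image_of_mem _ (H.apply_mem hφ)
    · generalize x s 0 = b
      change g.1 (r.1 ((double s g).1.symm _)) = _
      have h1 : canon ((Address.single s [b]).append ψ) μ =
          (double s g).1 (canon (Address.single s [b]) (canon φ (twist γ⁻¹ μ))) := by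
        rw [double_canon, H, twist_twist, mul_inv_cancel, twist_one, canon_append]
      rw [h1, Homeomorph.symm_apply_apply, hr, ← hd, rot_canon, H, twist_canon, twist_twist,
        mul_inv_cancel, twist_one, canon_append]

/-- With `γ = 1` the letter stays in coordinate `s`, so the comparison element only reorders the
concatenation and preserves lengths. -/
theorem map_eq_one_of_untwisted [Nonempty S] (g : twistedBrinThompsonGroup G S)
    (hg : ∀ κ, ∃ φ ψ : Address S, κ ∈ brick φ ∧ MapsByTwist g.1 φ ψ (1 : G)) : f g = 1 := by
  let s : S := Classical.arbitrary S
  obtain ⟨T, d, hT, h⟩ := exists_uniform_of_cover (fun φ => ∃ ψ, MapsByTwist g.1 φ ψ (1 : G))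
    (fun κ => by
      obtain ⟨φ, ψ, h1, h2⟩ := hg κ
      exact ⟨φ, ⟨ψ, h2⟩, h1⟩)
    (by
      rintro φ α ⟨ψ, h⟩
      exact ⟨_, h.append α⟩) {s}
  obtain ⟨w, hw, H⟩ := exists_compare f s g (d := d) (P := fun γ => γ = 1) fun κ => by
    obtain ⟨ψ, hψ⟩ := h (bits T d κ)
    exact ⟨_, ψ, 1, mem_brick_ofBits.2 rfl,
      length_ofBits_of_mem _ (hT (Finset.mem_singleton_self s)), rfl, hψ⟩
  rw [← inv_eq_one, ← hw]
  refine map_eq_one_of_level f w fun κ => ?_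
  obtain ⟨ψ, α, γ, rfl, h1, h2⟩ := H κ
  refine ⟨_, _, h1, fun t => ?_, h2⟩
  change (_ ++ _ : List Bool).length = (_ ++ α.word ((1 : G)⁻¹ • t)).length
  rw [inv_one, one_smul, List.length_append, List.length_append, add_comm]

/-- Every homomorphism to a commutative group is trivial. -/
theorem map_eq_one [Nonempty S] (g : twistedBrinThompsonGroup G S) : f g = 1 := by
  let s : S := Classical.arbitrary S
  obtain ⟨T, d, hT, h⟩ := exists_uniform_of_locAt (locAt_of_mem g.2) {s}
  obtain ⟨w, hw, H⟩ := exists_compare f s g (d := d) (P := fun _ => True) fun κ => by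
    obtain ⟨ψ, γ, hψ⟩ := h (bits T d κ)
    exact ⟨_, ψ, γ, mem_brick_ofBits.2 rfl,
      length_ofBits_of_mem _ (hT (Finset.mem_singleton_self s)), trivial, hψ⟩
  -- Whatever the twists of `g`, the comparison element `w` is untwisted.
  rw [← inv_eq_one, ← hw]
  refine map_eq_one_of_untwisted f w fun κ => ?_
  obtain ⟨ψ, α, γ, -, h1, h2⟩ := H κ
  exact ⟨_, _, h1, h2⟩

theorem commutator_eq_top [Nonempty S] : commutator (twistedBrinThompsonGroup G S) = ⊤ := by
  rw [← Abelianization.ker_of]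
  exact eq_top_iff.2 fun g _ => map_eq_one _ g

end
-- Simplicity
section
variable {S : Type*} {G : Type*} [Group G] [MulAction G S]

theorem commute_of_disjoint {A B : Set (CantorCube S)} (hAB : Disjoint A B)
    {g h : twistedBrinThompsonGroup G S} (hg : g.1 ∈ rist G A) (hh : h.1 ∈ rist G B) :
    Commute g h := by
  refine Subtype.ext (Homeomorph.ext fun x => ?_)
  change g.1 (h.1 x) = h.1 (g.1 x)
  by_cases hx : x ∈ A
  · rw [hh.2 x (disjoint_left.1 hAB hx),
      hh.2 _ (disjoint_left.1 hAB (apply_mem_of_mem_rist hg hx))]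
  · rw [hg.2 x hx]
    by_cases hx' : x ∈ B
    · rw [hg.2 _ (disjoint_right.1 hAB (apply_mem_of_mem_rist hh hx'))]
    · rw [hh.2 x hx', hg.2 x hx]

/-- For `x`, `y` supported in the brick, `⁅x, g⁆` is `x` times an element supported in the image of
the brick, which commutes with `y`. Hence `⁅⁅x, g⁆, y⁆ = ⁅x, y⁆`, and the left side lies in `N`.
Perfectness upgrades commutators to all elements. -/
theorem copy_mem_of_normal [Nonempty S] {N : Subgroup (twistedBrinThompsonGroup G S)}
    [hN : N.Normal] {g : twistedBrinThompsonGroup G S} (hg : g ∈ N) {φ : Address S}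
    (hφ : Disjoint (brick φ) (g.1 '' brick φ)) (u : twistedBrinThompsonGroup G S) :
    copy φ u ∈ N := by
  suffices h : commutator (twistedBrinThompsonGroup G S) ≤ N.comap (copy φ) by
    rw [commutator_eq_top] at h
    exact h (Subgroup.mem_top u)
  rw [commutator_def, Subgroup.commutator_le]
  intro a _ b _
  rw [Subgroup.mem_comap, map_commutatorElement]
  set x := copy φ a
  set y := copy φ b
  have hcomm : Commute (g * x⁻¹ * g⁻¹) y := by
    refine (commute_of_disjoint hφ (copy_mem φ b) ?_).symm
    have := inv_mem (copy_mem φ a)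
    exact conj_mem_rist this.1 g.2 this.2 fun z hz => mem_image_of_mem _ hz
  have hc : ⁅x, g⁆ ∈ N := by
    rw [commutatorElement_def]
    exact mul_mem (hN.conj_mem g hg x) (inv_mem hg)
  have h1 : ⁅⁅x, g⁆, y⁆ ∈ N := by
    rw [commutatorElement_def, mul_assoc, mul_assoc, ← mul_assoc y]
    exact mul_mem hc (hN.conj_mem _ (inv_mem hc) y)
  have h2 : ⁅⁅x, g⁆, y⁆ = ⁅x, y⁆ := by
    have h3 : ⁅x, g⁆ = x * (g * x⁻¹ * g⁻¹) := by simp only [commutatorElement_def, mul_assoc]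
    rw [h3, commutatorElement_def, mul_assoc x, hcomm.eq, commutatorElement_def, mul_inv_rev]
    simp only [mul_assoc, mul_inv_cancel_left]
  rwa [h2] at h1

instance isSimpleGroup [Nonempty S] : IsSimpleGroup (twistedBrinThompsonGroup G S) where
  eq_bot_or_eq_top_of_normal N hN := by
    refine or_iff_not_imp_left.2 fun hbot => ?_
    obtain ⟨g, hg, hg1⟩ := N.bot_or_exists_ne_one.resolve_left hbot
    obtain ⟨φ, hφ⟩ := exists_brick_disjoint_image g.1 fun h => hg1 (Subtype.ext h)
    suffices h : rist G univ ≤ N.map (twistedBrinThompsonGroup G S).subtype by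
      rw [rist_univ] at h
      refine eq_top_iff.2 fun x _ => ?_
      obtain ⟨x', hx', hxx'⟩ := h x.2
      rwa [← Subtype.ext hxx']
    refine rist_le fun x hx D _ hD hne hxD => ⟨⟨x, hx.1⟩, ?_, rfl⟩
    rw [SetLike.mem_coe]
    -- The support of `x` avoids `D`, so a conjugate of `x` is supported in `brick φ`.
    obtain ⟨k, hk, hkD⟩ := exists_rist_mapsTo (G := G) isClopen_univ hD.compl (isClopen_brick φ)
      (subset_univ _) (subset_univ _) (brick_nonempty φ) (by simpa using hne)
    have hmem : k * x * k⁻¹ ∈ rist G (brick φ) :=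
      conj_mem_rist hx.1 hk.1 (fun y hy => hxD y (not_not.1 hy)) hkD
    obtain ⟨u, hu⟩ := exists_copy_eq hmem
    have h1 := copy_mem_of_normal hg hφ u
    have h2 : copy φ u = ⟨k, hk.1⟩ * ⟨x, hx.1⟩ * (⟨k, hk.1⟩ : twistedBrinThompsonGroup G S)⁻¹ :=
      Subtype.ext hu
    rw [h2] at h1
    have := hN.conj_mem _ h1 (⟨k, hk.1⟩ : twistedBrinThompsonGroup G S)⁻¹
    simpa only [mul_assoc, inv_mul_cancel_left, inv_inv, inv_mul_cancel, mul_one] using this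

end

/-! ### Generation by commutators of torsion elements -/

section Group
variable {Γ : Type*} [Group Γ]

theorem normal_closure_of_conj_mem {s : Set Γ} (h : ∀ x ∈ s, ∀ g, g * x * g⁻¹ ∈ s) :
    (Subgroup.closure s).Normal where
  conj_mem n hn g := by
    have : Subgroup.closure s ≤ (Subgroup.closure s).comap (MulAut.conj g).toMonoidHom :=
      (Subgroup.closure_le _).2 fun x hx => Subgroup.subset_closure (h x hx g)
    exact this hn

theorem isOfFinOrder_conj {x : Γ} (h : IsOfFinOrder x) (g : Γ) : IsOfFinOrder (g * x * g⁻¹) :=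
  (MulAut.conj g).toMonoidHom.isOfFinOrder h

/-- Both the torsion elements and their commutators form conjugation-invariant sets, so each
generates a trivial subgroup or everything. The former generate `Γ` because of `t`; were the latter
trivial, `Γ` would be commutative, contrary to perfectness. -/
theorem closure_commutators_eq_top [IsSimpleGroup Γ] (hperf : commutator Γ = ⊤) {t : Γ}
    (ht : IsOfFinOrder t) (ht1 : t ≠ 1) :
    Subgroup.closure {x : Γ | ∃ u v : Γ, IsOfFinOrder u ∧ IsOfFinOrder v ∧ ⁅u, v⁆ = x} = ⊤ := by
  have h1 : Subgroup.closure {x : Γ | IsOfFinOrder x} = ⊤ := by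
    have := normal_closure_of_conj_mem (s := {x : Γ | IsOfFinOrder x})
      fun x hx g => isOfFinOrder_conj hx g
    refine this.eq_bot_or_eq_top.resolve_left fun h => ht1 ?_
    rw [← Subgroup.mem_bot, ← h]
    exact Subgroup.subset_closure ht
  have := normal_closure_of_conj_mem
    (s := {x : Γ | ∃ u v : Γ, IsOfFinOrder u ∧ IsOfFinOrder v ∧ ⁅u, v⁆ = x}) (by
      rintro _ ⟨u, v, hu, hv, rfl⟩ g
      exact ⟨_, _, isOfFinOrder_conj hu g, isOfFinOrder_conj hv g,
        (map_commutatorElement (MulAut.conj g) u v).symm⟩)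
  refine this.eq_bot_or_eq_top.resolve_left fun h => ?_
  have hcomm : ∀ u v : Γ, IsOfFinOrder u → IsOfFinOrder v → Commute u v := by
    intro u v hu hv
    rw [← commutatorElement_eq_one_iff_commute, ← Subgroup.mem_bot, ← h]
    exact Subgroup.subset_closure ⟨u, v, hu, hv, rfl⟩
  have hc1 : ∀ u : Γ, IsOfFinOrder u → ∀ v, Commute u v := by
    intro u hu v
    have : Subgroup.closure {x : Γ | IsOfFinOrder x} ≤ Subgroup.centralizer {u} :=
      (Subgroup.closure_le _).2 fun x hx => Subgroup.mem_centralizer_singleton_iff.2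
        (hcomm x u hx hu).eq
    rw [h1] at this
    have h2 : v * u = u * v := Subgroup.mem_centralizer_singleton_iff.1 (this (Subgroup.mem_top v))
    exact h2.symm
  have hc2 : ∀ u v : Γ, Commute u v := by
    intro u v
    have : Subgroup.closure {x : Γ | IsOfFinOrder x} ≤ Subgroup.centralizer {v} :=
      (Subgroup.closure_le _).2 fun x hx => Subgroup.mem_centralizer_singleton_iff.2
        (hc1 x hx v).eq
    rw [h1] at this
    exact Subgroup.mem_centralizer_singleton_iff.1 (this (Subgroup.mem_top u))
  have : commutator Γ ≤ ⊥ := by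
    rw [commutator_def, Subgroup.commutator_le]
    intro u _ v _
    rw [Subgroup.mem_bot, commutatorElement_eq_one_iff_commute]
    exact hc2 u v
  rw [hperf] at this
  exact bot_ne_top (eq_top_iff.2 this)

/-- Each of the finitely many generators involves only finitely many torsion elements. -/
theorem exists_commutator_generators [IsSimpleGroup Γ] (hperf : commutator Γ = ⊤) {t : Γ}
    (ht : IsOfFinOrder t) (ht1 : t ≠ 1) (hfg : Group.FG Γ) :
    ∃ (r : ℕ) (f : Fin r → Γ), (∀ i, IsOfFinOrder (f i)) ∧
      Subgroup.closure {x | ∃ i j, ⁅f i, f j⁆ = x} = ⊤ := by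
  classical
  let C : Finset Γ → Subgroup Γ := fun F => Subgroup.closure {x : Γ | ∃ u ∈ F, ∃ v ∈ F, ⁅u, v⁆ = x}
  have hmono : ∀ {F F' : Finset Γ}, F ⊆ F' → C F ≤ C F' := fun h => Subgroup.closure_mono (by
    rintro _ ⟨u, hu, v, hv, rfl⟩
    exact ⟨u, h hu, v, h hv, rfl⟩)
  have key : ∀ x : Γ, ∃ F : Finset Γ, (∀ u ∈ F, IsOfFinOrder u) ∧ x ∈ C F := by
    intro x
    have hx : x ∈ Subgroup.closure
        {x : Γ | ∃ u v : Γ, IsOfFinOrder u ∧ IsOfFinOrder v ∧ ⁅u, v⁆ = x} := by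
      rw [closure_commutators_eq_top hperf ht ht1]
      exact Subgroup.mem_top x
    induction hx using Subgroup.closure_induction with
    | mem x hx =>
      obtain ⟨u, v, hu, hv, rfl⟩ := hx
      refine ⟨{u, v}, by simp [hu, hv], Subgroup.subset_closure ⟨u, by simp, v, by simp, rfl⟩⟩
    | one => exact ⟨∅, by simp, one_mem _⟩
    | mul x y _ _ hx hy =>
      obtain ⟨F, hF, hxF⟩ := hx
      obtain ⟨F', hF', hyF⟩ := hy
      refine ⟨F ∪ F', fun u hu => (Finset.mem_union.1 hu).elim (hF u) (hF' u),
        mul_mem (hmono Finset.subset_union_left hxF) (hmono Finset.subset_union_right hyF)⟩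
    | inv x _ hx =>
      obtain ⟨F, hF, hxF⟩ := hx
      exact ⟨F, hF, inv_mem hxF⟩
  choose F hF hxF using key
  obtain ⟨X, hX⟩ := Group.fg_def.1 hfg
  let E := X.biUnion F
  have hE : ∀ u ∈ E, IsOfFinOrder u := fun u hu => by
    obtain ⟨x, -, hx⟩ := Finset.mem_biUnion.1 hu
    exact hF x u hx
  refine ⟨E.card, fun i => (E.equivFin.symm i).1, fun i => hE _ (E.equivFin.symm i).2, ?_⟩
  rw [eq_top_iff, ← hX, Subgroup.closure_le]
  intro x hx
  have h1 : x ∈ C E := hmono (Finset.subset_biUnion_of_mem F hx) (hxF x)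
  refine Subgroup.closure_mono ?_ h1
  rintro _ ⟨u, hu, v, hv, rfl⟩
  exact ⟨E.equivFin ⟨u, hu⟩, E.equivFin ⟨v, hv⟩, by simp⟩

/-- The commutator of two products whose factors commute in all but one instance. -/
theorem commutator_mul_of_commute {a b c d : Γ} (h1 : Commute a d) (h2 : Commute b c)
    (h3 : Commute b d) : ⁅a * b, c * d⁆ = ⁅a, c⁆ := by
  simp only [commutatorElement_def, mul_inv_rev, mul_assoc]
  rw [h2.left_comm, h3.left_comm, mul_inv_cancel_left, h1.inv_inv.left_comm, mul_inv_cancel_left]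

end Group
-- Powers of four as a Sidon set
theorem add_pow_four_eq {a b c d : ℕ} (h : 4 ^ a + 4 ^ b = 4 ^ c + 4 ^ d) :
    (a = c ∧ b = d) ∨ (a = d ∧ b = c) := by
  have hlt : ∀ {a b c d : ℕ}, a ≤ b → b < d → 4 ^ a + 4 ^ b < 4 ^ c + 4 ^ d := by
    intro a b c d hab hbd
    have h1 : 4 ^ a ≤ 4 ^ b := Nat.pow_le_pow_right (by norm_num) hab
    have h2 : 4 ^ (b + 1) ≤ 4 ^ d := Nat.pow_le_pow_right (by norm_num) hbd
    have h3 : 0 < 4 ^ b := by positivity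
    have h4 : 0 < 4 ^ c := by positivity
    rw [pow_succ] at h2
    omega
  have key : ∀ {a b c d : ℕ}, a ≤ b → c ≤ d → 4 ^ a + 4 ^ b = 4 ^ c + 4 ^ d → a = c ∧ b = d := by
    intro a b c d hab hcd h
    have hbd : b = d := by
      rcases lt_trichotomy b d with h' | h' | h'
      · exact absurd h (hlt hab h').ne
      · exact h'
      · exact absurd h (hlt hcd h').ne'
    subst hbd
    exact ⟨Nat.pow_right_injective (le_refl _ |>.trans (by norm_num)) (Nat.add_right_cancel h), rfl⟩
  rcases le_total a b with hab | hab <;> rcases le_total c d with hcd | hcd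
  · exact Or.inl (key hab hcd h)
  · exact Or.inr (key hab hcd (by omega))
  · have := key hab hcd (by omega)
    exact Or.inr ⟨this.2, this.1⟩
  · have := key hab hcd (by omega)
    exact Or.inl ⟨this.2, this.1⟩

/-- Powers of four form a Sidon set, with separated sums, modulo a larger power of four. -/
theorem sidon_zmod {r i j l m : ℕ} (hi : i < r) (hj : j < r) (hl : l < r) (hm : m < r) {e : ℤ}
    (he : |e| ≤ 1) (h : ((4 : ZMod (4 ^ (r + 2))) ^ (l + 1) + 4 ^ (j + 1)) =
      4 ^ (m + 1) + 4 ^ (i + 1) + e) : (l = m ∧ j = i) ∨ (l = i ∧ j = m) := by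
  have hb : ∀ {n : ℕ}, n < r → (4 : ℤ) ^ (n + 1) ≤ 4 ^ r := fun hn =>
    pow_le_pow_right₀ (by norm_num) hn
  have hp : ∀ n : ℕ, (0 : ℤ) < 4 ^ (n + 1) := fun n => by positivity
  have h0 : (((4 : ℤ) ^ (l + 1) + 4 ^ (j + 1) - (4 ^ (m + 1) + 4 ^ (i + 1) + e) : ℤ) :
      ZMod (4 ^ (r + 2))) = 0 := by
    push_cast
    rw [h, sub_self]
  -- Every power is at most `4 ^ r`, so the difference is smaller than the modulus and the
  -- congruence is an equality of integers. Divisibility of the powers by 4 then forces `e = 0`.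
  have h1 := Int.eq_zero_of_abs_lt_dvd ((ZMod.intCast_zmod_eq_zero_iff_dvd _ _).1 h0) (by
    have := hb hi
    have := hb hj
    have := hb hl
    have := hb hm
    have := hp i
    have := hp j
    have := hp l
    have := hp m
    have h4 : (0 : ℤ) < 4 ^ r := by positivity
    rw [abs_le] at he
    rw [abs_lt]
    push_cast
    rw [pow_add]
    constructor <;> linarith)
  have h2 : (4 : ℤ) * (4 ^ l + 4 ^ j) = 4 * (4 ^ m + 4 ^ i) + e := by
    simp only [pow_succ] at h1
    linarith
  have h3 : e = 0 := by
    rw [abs_le] at he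
    omega
  have h4 : (4 : ℤ) ^ l + 4 ^ j = 4 ^ m + 4 ^ i := by linarith
  exact add_pow_four_eq (by exact_mod_cast h4)

/-! ### The cyclic torsion element and the two generators -/

section
variable {S : Type*} {G : Type*} [Group G] [MulAction G S]

theorem exists_equiv_zero_one {W : Type*} [Fintype W] {M : ℕ} [NeZero M] (hM : 1 < M)
    (hW : Fintype.card W = M) {a b : W} (hab : a ≠ b) : ∃ e : W ≃ ZMod M, e a = 0 ∧ e b = 1 := by
  classical
  have : Nontrivial (ZMod M) := ZMod.nontrivial_iff.2 hM.ne'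
  let e₀ : W ≃ ZMod M := Fintype.equivOfCardEq (by rw [hW, ZMod.card])
  let e₁ := e₀.trans (Equiv.swap (e₀ a) 0)
  have h1 : e₁ a = 0 := by simp [e₁]
  refine ⟨e₁.trans (Equiv.swap (e₁ b) 1), ?_, by simp⟩
  have h2 : (0 : ZMod M) ≠ e₁ b := fun h => hab (e₁.injective (h1.trans h))
  change Equiv.swap (e₁ b) 1 (e₁ a) = 0
  rw [h1, Equiv.swap_apply_of_ne_of_ne h2 zero_ne_one]

/-- A torsion element permuting cyclically the parts of a clopen partition, the union of two
consecutive parts being a brick. -/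
theorem exists_cycle [Nonempty S] {d M : ℕ} [NeZero M] (hd : 0 < d) (hM : M = 2 ^ d) :
    ∃ (σ : twistedBrinThompsonGroup G S) (v : CantorCube S → ZMod M) (α : Address S),
      IsOfFinOrder σ ∧ (∀ κ, v (σ.1 κ) = v κ + 1) ∧ Function.Surjective v ∧
      ∀ κ, κ ∈ brick α ↔ v κ = 0 ∨ v κ = 1 := by
  classical
  let s : S := Classical.arbitrary S
  let T : Finset S := {s}
  -- The words `0…00` and `0…01` get the numbers 0 and 1, so that their union is the brick of `0…0`
  -- with `d - 1` letters.
  let a : T → Fin d → Bool := fun _ _ => false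
  let b : T → Fin d → Bool := fun _ n => decide (n.1 = d - 1)
  have hab : a ≠ b := fun h => by
    have := congrFun (congrFun h ⟨s, Finset.mem_singleton_self s⟩) ⟨d - 1, by omega⟩
    simp [a, b] at this
  obtain ⟨e, ea, eb⟩ := exists_equiv_zero_one (M := M) (by
    rw [hM]
    exact Nat.one_lt_two_pow hd.ne') (by simp [T, hM]) hab
  have hv : ∀ κ, bits T d (permFun ((e.trans (Equiv.addRight 1)).trans e.symm) κ : CantorCube S) =
      e.symm (e (bits T d κ) + 1) := fun κ => bits_permFun _ κ
  refine ⟨permHom G ((e.trans (Equiv.addRight 1)).trans e.symm), fun κ => e (bits T d κ),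
    Address.single s (List.replicate (d - 1) false), ?_, fun κ => ?_, fun c => ?_, fun κ => ?_⟩
  · exact (permHom G).isOfFinOrder (isOfFinOrder_of_finite _)
  · rw [permHom_apply]
    change e (bits T d (permFun _ κ)) = e (bits T d κ) + 1
    rw [hv, e.apply_symm_apply]
  · obtain ⟨κ, hκ⟩ := brick_nonempty (ofBits (e.symm c))
    refine ⟨κ, ?_⟩
    change e (bits T d κ) = c
    rw [mem_brick_ofBits.1 hκ, e.apply_symm_apply]
  · rw [← ea, ← eb, e.injective.eq_iff, e.injective.eq_iff, mem_brick_single]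
    constructor
    · intro h
      have h' : ∀ n < d - 1, κ s n = false := fun n hn =>
        (h n (by simpa using hn)).trans (List.getElem_replicate _)
      have hbit : ∀ (t : T) (n : Fin d), bits T d κ t n = κ s n := fun t n => by
        change κ t n = κ s n
        rw [Finset.mem_singleton.1 t.2]
      cases hκ : κ s (d - 1)
      · left
        funext t n
        rw [hbit]
        by_cases hn : n.1 = d - 1
        · rw [hn, hκ]
        · exact h' n (by omega)
      · right
        funext t n
        rw [hbit]
        by_cases hn : n.1 = d - 1
        · rw [hn, hκ]
          simp [b, hn]
        · rw [h' n (by omega)]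
          simp [b, hn]
    · rintro (h | h) n hn
      · have hn' : n < d := by
          rw [List.length_replicate] at hn
          omega
        have := congrFun (congrFun h ⟨s, Finset.mem_singleton_self s⟩) ⟨n, hn'⟩
        simpa [bits, a] using this
      · rw [List.length_replicate] at hn
        have := congrFun (congrFun h ⟨s, Finset.mem_singleton_self s⟩) ⟨n, by omega⟩
        have hne : n ≠ d - 1 := by omega
        simpa [bits, b, hne] using this

section Cycle
variable {M : ℕ} {σ : twistedBrinThompsonGroup G S} {v : CantorCube S → ZMod M} {α : Address S}

/-- The set where `v` takes the values `c` or `c + 1`. -/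
def pairSet (v : CantorCube S → ZMod M) (c : ZMod M) : Set (CantorCube S) :=
  {κ | v κ = c ∨ v κ = c + 1}

theorem apply_pow (hσ : ∀ κ, v (σ.1 κ) = v κ + 1) (k : ℕ) (κ : CantorCube S) :
    v ((σ ^ k).1 κ) = v κ + k := by
  induction k with
  | zero => simp
  | succ k ih =>
    rw [pow_succ']
    change v (σ.1 ((σ ^ k).1 κ)) = _
    rw [hσ, ih]
    push_cast
    ring

theorem pairSet_of_pow (hσ : ∀ κ, v (σ.1 κ) = v κ + 1) {c c' : ZMod M} {k : ℕ} (h : c + k = c') :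
    ∀ x ∈ pairSet v c, (σ ^ k).1 x ∈ pairSet v c' := by
  subst h
  rintro x (hx | hx)
  · left
    rw [apply_pow hσ, hx]
  · right
    rw [apply_pow hσ, hx]
    ring

theorem pairSet_of_inv_pow (hσ : ∀ κ, v (σ.1 κ) = v κ + 1) {c c' : ZMod M} {k : ℕ}
    (h : c' + k = c) : ∀ x ∈ pairSet v c, (σ ^ k)⁻¹.1 x ∈ pairSet v c' := by
  subst h
  intro x hx
  obtain ⟨y, rfl⟩ := (σ ^ k).1.surjective x
  have h1 : (σ ^ k)⁻¹.1 ((σ ^ k).1 y) = y := (σ ^ k).1.symm_apply_apply y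
  rw [h1]
  rcases hx with hx | hx
  · left
    rw [apply_pow hσ] at hx
    exact add_right_cancel hx
  · right
    rw [apply_pow hσ, add_right_comm] at hx
    exact add_right_cancel hx

/-- Two pairs of consecutive residues meet only if their starting points differ by at most one; this
is the origin of the error term `e` in `sidon_zmod`. -/
theorem disjoint_pairSet {c c' : ZMod M} (h : ∀ e : ℤ, |e| ≤ 1 → c ≠ c' + e) :
    Disjoint (pairSet v c) (pairSet v c') := by
  refine disjoint_left.2 ?_
  rintro x (hx | hx) (hx' | hx')
  · exact h 0 (by norm_num) (by push_cast; rw [← hx, hx', add_zero])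
  · exact h 1 (by norm_num) (by push_cast; rw [← hx, hx'])
  · exact h (-1) (by norm_num) (by push_cast; rw [← hx', hx]; ring)
  · exact h 0 (by norm_num) (by
      push_cast
      rw [add_zero]
      exact add_right_cancel (hx.symm.trans hx'))

theorem isClopen_pairSet (hσ : ∀ κ, v (σ.1 κ) = v κ + 1)
    (hα : ∀ κ, κ ∈ brick α ↔ v κ = 0 ∨ v κ = 1) (k : ℕ) : IsClopen (pairSet v (k : ZMod M)) := by
  have h0 : brick α = pairSet v 0 := by
    ext κ
    rw [hα]
    simp [pairSet]
  have : pairSet v (k : ZMod M) = (σ ^ k)⁻¹.1 ⁻¹' brick α := by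
    ext x
    constructor
    · intro hx
      rw [mem_preimage, h0]
      exact pairSet_of_inv_pow hσ (zero_add _) x hx
    · intro hx
      rw [mem_preimage, h0] at hx
      have := pairSet_of_pow hσ (zero_add (k : ZMod M)) _ hx
      have h1 : (σ ^ k).1 ((σ ^ k)⁻¹.1 x) = x := (σ ^ k).1.apply_symm_apply x
      rwa [h1] at this
  rw [this]
  exact (isClopen_brick α).preimage (σ ^ k)⁻¹.1.continuous

/-- A subgroup containing the cyclic element and the elements supported in the brick is
everything. -/
theorem eq_top_of_rist_le [Nonempty S] [NeZero M] (hσ : ∀ κ, v (σ.1 κ) = v κ + 1)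
    (hv : Function.Surjective v) (hα : ∀ κ, κ ∈ brick α ↔ v κ = 0 ∨ v κ = 1)
    {H : Subgroup (twistedBrinThompsonGroup G S)} (hσH : σ ∈ H)
    (hH : ∀ g : twistedBrinThompsonGroup G S, g.1 ∈ rist G (brick α) → g ∈ H) : H = ⊤ := by
  have h0 : brick α = pairSet v 0 := by
    ext κ
    rw [hα]
    simp [pairSet]
  have h1 : ∀ k : ℕ, rist G (pairSet v (k : ZMod M)) ≤
      H.map (twistedBrinThompsonGroup G S).subtype := by
    intro k g hg
    refine ⟨⟨g, hg.1⟩, ?_, rfl⟩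
    rw [SetLike.mem_coe]
    have hk : σ ^ k ∈ H := pow_mem hσH k
    have := hH ((σ ^ k)⁻¹ * ⟨g, hg.1⟩ * ((σ ^ k)⁻¹)⁻¹) (conj_mem_rist hg.1 (σ ^ k)⁻¹.2 hg.2 (by
      rw [h0]
      exact pairSet_of_inv_pow hσ (zero_add _)))
    have h2 := mul_mem (mul_mem hk this) (inv_mem hk)
    simpa only [mul_assoc, mul_inv_cancel_left, inv_inv, mul_inv_cancel, mul_one] using h2
  -- Successive pairs share a part, so `rist_union_le` applies. This is why the brick consists of
  -- two parts and not one.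
  have h2 : ∀ k : ℕ, IsClopen (⋃ i ∈ Finset.range (k + 1), pairSet v (i : ZMod M)) ∧
      rist G (⋃ i ∈ Finset.range (k + 1), pairSet v (i : ZMod M)) ≤
        H.map (twistedBrinThompsonGroup G S).subtype := by
    intro k
    refine ⟨isClopen_biUnion_finset fun i _ => isClopen_pairSet hσ hα i, ?_⟩
    induction k with
    | zero => simpa using h1 0
    | succ k ih =>
      rw [Finset.range_add_one, Finset.set_biUnion_insert]
      refine rist_union_le (isClopen_pairSet hσ hα _)
        (isClopen_biUnion_finset fun i _ => isClopen_pairSet hσ hα i) ?_ (h1 _) ih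
      obtain ⟨x, hx⟩ := hv ((k + 1 : ℕ) : ZMod M)
      refine ⟨x, Or.inl hx, mem_iUnion₂.2 ⟨k, Finset.self_mem_range_succ k, Or.inr ?_⟩⟩
      rw [hx]
      push_cast
      rfl
  have h3 : (⋃ i ∈ Finset.range (M + 1), pairSet v (i : ZMod M)) = univ := by
    refine eq_univ_of_forall fun x => mem_iUnion₂.2 ⟨(v x).val, ?_, Or.inl ?_⟩
    · exact Finset.mem_range.2 ((ZMod.val_lt _).trans (Nat.lt_succ_self M))
    · simp
  have h4 := (h2 M).2
  rw [h3, rist_univ] at h4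
  refine eq_top_iff.2 fun g _ => ?_
  obtain ⟨g', hg', h⟩ := h4 g.2
  rwa [← Subtype.ext h]

end Cycle

theorem isOfFinOrder_pi {ι : Type*} [Fintype ι] {Γ : Type*} [Group Γ] {f : ι → Γ}
    (hf : ∀ i, IsOfFinOrder (f i)) : IsOfFinOrder f := by
  rw [isOfFinOrder_iff_pow_eq_one]
  refine ⟨∏ i, orderOf (f i), Finset.prod_pos fun i _ => (hf i).orderOf_pos, funext fun i => ?_⟩
  exact orderOf_dvd_iff_pow_eq_one.1 (Finset.dvd_prod_of_mem _ (Finset.mem_univ i))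

theorem exists_two_generators [Nonempty S] (hfg : Group.FG (twistedBrinThompsonGroup G S)) :
    ∃ a b : twistedBrinThompsonGroup G S,
      IsOfFinOrder a ∧ IsOfFinOrder b ∧ Subgroup.closure {a, b} = ⊤ := by
  classical
  obtain ⟨t, ht, ht1⟩ : ∃ t : twistedBrinThompsonGroup G S, IsOfFinOrder t ∧ t ≠ 1 := by
    obtain ⟨t, v, -, ht, htv, -⟩ := exists_cycle (S := S) (G := G) (d := 1) (M := 2) (by norm_num)
      (by norm_num)
    refine ⟨t, ht, ?_⟩
    rintro rfl
    have := htv fun _ _ => false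
    exact one_ne_zero (left_eq_add.1 this)
  obtain ⟨r, f, hf, hgen⟩ := exists_commutator_generators commutator_eq_top ht ht1 hfg
  obtain ⟨σ, v, α, hσ, hσv, hv, hα⟩ := exists_cycle (S := S) (G := G) (d := 2 * (r + 2))
    (M := 4 ^ (r + 2)) (by omega) (by rw [pow_mul]; norm_num)
  have h0 : brick α = pairSet v 0 := by
    ext κ
    rw [hα]
    simp [pairSet]
  let k : Fin r → ℕ := fun i => 4 ^ (i.1 + 1)
  have sidon : ∀ (i j l m : Fin r) (e : ℤ), |e| ≤ 1 →
      (k l + k j : ZMod (4 ^ (r + 2))) = k m + k i + e → (l = m ∧ j = i) ∨ (l = i ∧ j = m) := by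
    intro i j l m e he h
    simp only [Fin.ext_iff]
    refine sidon_zmod i.2 j.2 l.2 m.2 he ?_
    simpa [k] using h
  let Φ : Fin r → twistedBrinThompsonGroup G S →* twistedBrinThompsonGroup G S :=
    fun i => (MulAut.conj (σ ^ k i)).toMonoidHom.comp (copy α)
  have hΦ : ∀ i x, (Φ i x).1 ∈ rist G (pairSet v (k i)) := fun i x =>
    conj_mem_rist (copy α x).2 (σ ^ k i).2 (copy_mem α x).2 (by
      rw [h0]
      exact pairSet_of_pow hσv (zero_add _))
  -- The Sidon property with a repeated index separates the translates of the brick. The factors of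
  -- `ζ` therefore commute, and `ζ` has finite order.
  have hcomm : Pairwise fun i j => ∀ x y, Commute (Φ i x) (Φ j y) := by
    intro i j hij x y
    refine commute_of_disjoint (disjoint_pairSet fun e he h => ?_) (hΦ i x) (hΦ j y)
    rcases sidon i i i j e he (by rw [h]; ring) with h' | h'
    · exact hij h'.1
    · exact hij h'.2
  let ζ : twistedBrinThompsonGroup G S := MonoidHom.noncommPiCoprod Φ hcomm f
  have hζ : IsOfFinOrder ζ := MonoidHom.isOfFinOrder _ (isOfFinOrder_pi hf)
  refine ⟨σ, ζ, hσ, hζ, ?_⟩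
  set H := Subgroup.closure {σ, ζ} with hH
  have hσH : σ ∈ H := Subgroup.subset_closure (by simp)
  have hζH : ζ ∈ H := Subgroup.subset_closure (by simp)
  -- the remaining factors
  let B : Fin r → Set (CantorCube S) := fun i => ⋃ l ∈ {l | l ≠ i}, pairSet v (k l - k i)
  -- Conjugation by `σ ^ k i` inverse brings factor `i` of `ζ` back to the brick and factor `l` to
  -- the pair at `k l - k i`.
  have hR : ∀ i, ∃ R : twistedBrinThompsonGroup G S, R.1 ∈ rist G (B i) ∧
      copy α (f i) * R ∈ H := by
    intro i
    let g : twistedBrinThompsonGroup G S :=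
      MonoidHom.noncommPiCoprod Φ hcomm (Function.update f i 1)
    have hg : ∀ x ∉ ⋃ l ∈ {l | l ≠ i}, pairSet v (k l : ZMod (4 ^ (r + 2))), g.1 x = x := by
      let K := (rist G (⋃ l ∈ {l | l ≠ i}, pairSet v (k l : ZMod (4 ^ (r + 2))))).comap
        (twistedBrinThompsonGroup G S).subtype
      have : g ∈ K := by
        refine K.noncommProd_mem (fun _ _ _ _ h => hcomm h _ _) fun l _ => ?_
        by_cases hl : l = i
        · subst hl
          rw [Function.update_self, map_one]
          exact one_mem _
        · rw [Function.update_of_ne hl]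
          exact rist_mono (subset_biUnion_of_mem (u := fun l => pairSet v (k l : ZMod (4 ^ (r + 2))))
            (show l ∈ {l | l ≠ i} from hl)) (hΦ l (f l))
      exact this.2
    have hsplit : ζ = Φ i (f i) * g := by
      rw [← MonoidHom.noncommPiCoprod_mulSingle (ϕ := Φ) (hcomm := hcomm), ← map_mul]
      change MonoidHom.noncommPiCoprod Φ hcomm f = _
      congr 1
      funext l
      by_cases hl : l = i
      · subst hl
        simp
      · simp [hl]
    refine ⟨(σ ^ k i)⁻¹ * g * ((σ ^ k i)⁻¹)⁻¹, conj_mem_rist g.2 (σ ^ k i)⁻¹.2 hg ?_, ?_⟩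
    · intro x hx
      obtain ⟨l, hl, hx⟩ := mem_iUnion₂.1 hx
      exact mem_iUnion₂.2 ⟨l, hl, pairSet_of_inv_pow hσv (by ring) x hx⟩
    · have h1 : (σ ^ k i)⁻¹ * ζ * σ ^ k i ∈ H :=
        mul_mem (mul_mem (inv_mem (pow_mem hσH _)) hζH) (pow_mem hσH _)
      have h2 : Φ i (f i) = σ ^ k i * copy α (f i) * (σ ^ k i)⁻¹ := rfl
      rw [hsplit, h2] at h1
      simpa only [mul_assoc, inv_mul_cancel_left, inv_inv] using h1
  choose R hRB hRH using hR
  have hAB : ∀ i, Disjoint (brick α) (B i) := by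
    intro i
    rw [h0]
    refine disjoint_iUnion₂_right.2 fun l hl => disjoint_pairSet fun e he h => hl ?_
    rcases sidon l i i i e he (by linear_combination h) with h' | h'
    · exact h'.2.symm
    · exact h'.1.symm
  -- A common point gives `k l + k j = k m + k i + e`, which the Sidon property excludes as `i ≠ j`
  -- and `l ≠ i`.
  have hBB : ∀ i j, i ≠ j → Disjoint (B i) (B j) := by
    intro i j hij
    refine disjoint_iUnion₂_left.2 fun l hl => disjoint_iUnion₂_right.2 fun m hm =>
      disjoint_pairSet fun e he h => ?_
    rcases sidon i j l m e he (by linear_combination h) with h' | h'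
    · exact hij h'.2.symm
    · exact hl h'.1
  have hcopy : ∀ i j, copy α ⁅f i, f j⁆ ∈ H := by
    intro i j
    by_cases hij : i = j
    · rw [hij, commutatorElement_self, map_one]
      exact one_mem H
    · rw [map_commutatorElement, ← commutator_mul_of_commute
        (commute_of_disjoint (hAB j) (copy_mem α (f i)) (hRB j))
        (commute_of_disjoint (hAB i) (copy_mem α (f j)) (hRB i)).symm
        (commute_of_disjoint (hBB i j hij) (hRB i) (hRB j)), commutatorElement_def]
      exact mul_mem (mul_mem (mul_mem (hRH i) (hRH j)) (inv_mem (hRH i))) (inv_mem (hRH j))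
  refine eq_top_of_rist_le hσv hv hα hσH fun g hg => ?_
  obtain ⟨u, hu⟩ := exists_copy_eq hg
  rw [← Subtype.ext hu]
  -- The elements whose copy lies in `H` form a subgroup, which contains the generating commutators.
  have hle : (⊤ : Subgroup (twistedBrinThompsonGroup G S)) ≤ H.comap (copy α) := by
    rw [← hgen, Subgroup.closure_le]
    rintro _ ⟨i, j, rfl⟩
    exact hcopy i j
  exact hle (Subgroup.mem_top u)

end
end BrinThompson

theorem mainTheorem6 (G S : Type*) [Group G] [MulAction G S] [FaithfulSMul G S] [Nonempty S] :
    IsSimpleGroup (BrinThompson.twistedBrinThompsonGroup G S) ∧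
    (Group.FG (BrinThompson.twistedBrinThompsonGroup G S) →
      ∃ a b : BrinThompson.twistedBrinThompsonGroup G S,
        IsOfFinOrder a ∧ IsOfFinOrder b ∧ Subgroup.closure {a, b} = ⊤) :=
  ⟨inferInstance, BrinThompson.exists_two_generators⟩
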